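/- Let $d\ge 1$ and let $\mathbb{E}^d$ denote $d$-dimensional Euclidean space with origin $o$. For a bounded set $P\subset\mathbb{E}^d$ let $\mathrm{cr}(P)$ (circumradius) be the radius of a smallest ball containing $P$, and let $\mathrm{ir}(P)$ (inradius) be the radius of a largest ball contained in $P$, whenever such balls exist. Let $D$ be an open ball centred at $o$ with radius $R_0<\infty$, or let $D=\mathbb{E}^d$ and $R_0=\infty$. Let $\rho:[0,R_0)\to[0,\infty)$ be a function, and let $S_{\mathrm{reg}}\subset D$ be a regular $d$-dimensional simplex centred at $o$. (i) If $\rho$ is decreasing (not necessarily strictly), then for every simplex $S\subset D$ (of any dimension) with $\mathrm{cr}(S)=\mathrm{cr}(S_{\mathrm{reg}})$, the function $x\mapsto\rho(\|x\|)$ is integrable on $S$ and $$\int_S \rho(\|x\|)\,dx\le\int_{S_{\mathrm{reg}}}\rho(\|x\|)\,dx .$$ If moreover $\rho$ is strictly decreasing, then equality holds if and only if $S$ is congruent to $S_{\mathrm{reg}}$ and the centre (centroid) of $S$ is $o$. (ii) If $\rho$ is increasing (not necessarily strictly), then for every $d$-dimensional simplex $S\subset D$ with $\mathrm{ir}(S)=\mathrm{ir}(S_{\mathrm{reg}})$,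 the function $x\mapsto\rho(\|x\|)$ is integrable on $S$ and $$\int_S \rho(\|x\|)\,dx\ge\int_{S_{\mathrm{reg}}}\rho(\|x\|)\,dx .$$ If moreover $\rho$ is strictly increasing, then equality holds if and only if $S$ is congruent to $S_{\mathrm{reg}}$ and the centre (centroid) of $S$ is $o$. Here $dx$ denotes $d$-dimensional Lebesgue measure. -/

import Mathlib

open MeasureTheory

noncomputable section

/-- The radius of a smallest ball containing `P`. -/
def outerRadius {d : ℕ} (P : Set (EuclideanSpace ℝ (Fin d))) : ℝ :=
  sInf {r : ℝ | 0 ≤ r ∧ ∃ c, P ⊆ Metric.closedBall c r}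

/-- The radius of a largest ball contained in `P`. -/
def innerRadius {d : ℕ} (P : Set (EuclideanSpace ℝ (Fin d))) : ℝ :=
  sSup {r : ℝ | 0 ≤ r ∧ ∃ c, Metric.closedBall c r ⊆ P}

/-- The open ball of radius `R₀` centred at the origin; all of `E^d` when `R₀ = ⊤`. -/
def centredDomain (d : ℕ) (R₀ : EReal) : Set (EuclideanSpace ℝ (Fin d)) :=
  {x | (‖x‖ : EReal) < R₀}

/-- The interval `[0, R₀)`. -/
def radiusInterval (R₀ : EReal) : Set ℝ :=
  {t | 0 ≤ t ∧ (t : EReal) < R₀}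

/-- The two sets are congruent: an isometry of the space carries one onto the other. -/
def AreCongruent {d : ℕ} (A B : Set (EuclideanSpace ℝ (Fin d))) : Prop :=
  ∃ f : EuclideanSpace ℝ (Fin d) ≃ᵢ EuclideanSpace ℝ (Fin d), f '' A = B

/-- The integral over `A` of the density `x ↦ ρ(‖x‖)` with respect to Lebesgue measure. -/
def radialMeasure {d : ℕ} (ρ : ℝ → ℝ) (A : Set (EuclideanSpace ℝ (Fin d))) : ℝ :=
  ∫ x in A, ρ ‖x‖

/-- The centre (barycentre of the vertices) of a simplex. -/
def simplexCentre {d k : ℕ} (S : Affine.Simplex ℝ (EuclideanSpace ℝ (Fin d)) k) :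
    EuclideanSpace ℝ (Fin d) :=
  Finset.univ.centroid ℝ S.points

end

/-!
# Extremal simplices for radial densities

The proof symmetrizes a simplex along its edges. For an edge `[p j, p i]` of a simplex `S`, Steiner
symmetrization with respect to the hyperplane through the origin orthogonal to the edge produces
again a simplex `S'`: over each line parallel to the edge the chord of `S` is translated until the
hyperplane bisects it. There is an affine involution `edgeSwap` that exchanges `S` and `S'`, and it
decreases the norm on `S \ S'` (`norm_edgeSwap_lt`). Therefore `S'` has the same volume as `S`, at
least as large an integral of any decreasing radial density (`lintegral_le_symmetral`), a
circumradius that is not larger (`outerRadius_symmetral_le`) and an inradius that is not smaller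
(`innerRadius_le_symmetral`). Moreover the sum of the squared norms of the vertices decreases
strictly unless the edge is *balanced*, that is, `S' = S` (`sum_norm_sq_edgeSwap_lt`).

No sequence of symmetrizations is needed. The vertex tuples that are at least as good as `S` in all
of these respects form a compact set, and a minimizer of the sum of squared norms on it has only
balanced edges (`exists_balanced_improvement`). The vertices of such a simplex have a Gram matrix
with constant diagonal and constant off-diagonal entries, so the simplex is the image of the given
regular one under a linear similarity (`IsCentredRegular.exists_similarity`). Comparing circumradii
or inradii decides whether the ratio is at most or at least one, and the inequality follows by
inclusion. Increasing densities `ρ` are treated through the decreasing density `C - ρ`, the volume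
being constant along the way.

In the case of equality with a strictly monotone density all edges of `S` must be balanced already,
since otherwise one symmetrization would strictly improve the integral. Conversely, a congruence
between two centred simplices carries vertices to vertices, hence fixes the origin and preserves the
density.
-/

open scoped RealInnerProductSpace

/-! ### Symmetrization of a simplex along an edge -/

section EdgeSwap

variable {ι E : Type*} [NormedAddCommGroup E] [InnerProductSpace ℝ E]
  (b : AffineBasis ι ℝ E) {i j : ι}

/-- Position of `x` along the edge from `b j` to `b i`, in units of that edge, measured from the
hyperplane through the origin orthogonal to the edge. -/
noncomputable def edgeHeight (b : AffineBasis ι ℝ E) (i j : ι) : E →ₗ[ℝ] ℝ :=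
  (‖b i - b j‖ ^ 2)⁻¹ • (innerₗ E (b i - b j))

/-- Position of `x` along the edge from `b j` to `b i`, in units of that edge, measured from the
midpoint of the chord of the simplex through `x` parallel to the edge. -/
noncomputable def edgeSkew (b : AffineBasis ι ℝ E) (i j : ι) : E →ᵃ[ℝ] ℝ :=
  (2⁻¹ : ℝ) • (b.coord i - b.coord j)

/-- The affine involution reversing every line parallel to the edge `b i - b j` in such a way that
the chord of the simplex on that line is exchanged with its translate centred on the hyperplane
through the origin orthogonal to the edge. It maps the simplex onto its Steiner symmetral with
respect to that hyperplane. -/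
noncomputable def edgeSwap (b : AffineBasis ι ℝ E) (i j : ι) : E →ᵃ[ℝ] E :=
  AffineMap.id ℝ E - (LinearMap.toSpanSingleton ℝ E (b i - b j)).toAffineMap.comp
    ((edgeHeight b i j).toAffineMap + edgeSkew b i j)

lemma edgeSwap_apply (x : E) :
    edgeSwap b i j x = x - (edgeHeight b i j x + edgeSkew b i j x) • (b i - b j) := by
  simp [edgeSwap, add_smul]

lemma edgeHeight_apply (x : E) :
    edgeHeight b i j x = (‖b i - b j‖ ^ 2)⁻¹ * ⟪b i - b j, x⟫ := by
  simp only [edgeHeight, LinearMap.smul_apply, innerₗ_apply_apply, smul_eq_mul]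

lemma edgeSkew_apply (x : E) : edgeSkew b i j x = (b.coord i x - b.coord j x) / 2 := by
  simp [edgeSkew]; ring

lemma edge_ne_zero (hij : i ≠ j) : b i - b j ≠ 0 :=
  sub_ne_zero.2 fun h => hij (b.ind.injective h)

lemma inner_edge (hij : i ≠ j) (x : E) :
    ⟪b i - b j, x⟫ = edgeHeight b i j x * ‖b i - b j‖ ^ 2 := by
  have : ‖b i - b j‖ ≠ 0 := norm_ne_zero_iff.2 (edge_ne_zero b hij)
  rw [edgeHeight_apply]; field_simp

lemma edgeHeight_edge (hij : i ≠ j) : edgeHeight b i j (b i - b j) = 1 := by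
  have : ‖b i - b j‖ ≠ 0 := norm_ne_zero_iff.2 (edge_ne_zero b hij)
  rw [edgeHeight_apply, real_inner_self_eq_norm_sq]; field_simp

lemma edgeHeight_add_smul_edge (hij : i ≠ j) (x : E) (t : ℝ) :
    edgeHeight b i j (x + t • (b i - b j)) = edgeHeight b i j x + t := by
  simp only [map_add, map_smul, edgeHeight_edge b hij, smul_eq_mul, mul_one]

lemma coord_add_smul_edge [DecidableEq ι] (k : ι) (x : E) (t : ℝ) :
    b.coord k (x + t • (b i - b j)) =
      b.coord k x + t * ((if k = i then 1 else 0) - if k = j then 1 else 0) := by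
  have h (v : E) : b.coord k (x + v) = (b.coord k).linear v + b.coord k x := by
    rw [add_comm x v]; exact (b.coord k).map_vadd x v
  have h' : (b.coord k).linear (b i - b j) = b.coord k (b i) - b.coord k (b j) := 
    (b.coord k).linearMap_vsub _ _
  rw [h, map_smul, h', b.coord_apply, b.coord_apply, smul_eq_mul]; ring

lemma edgeSkew_add_smul_edge (hij : i ≠ j) (x : E) (t : ℝ) :
    edgeSkew b i j (x + t • (b i - b j)) = edgeSkew b i j x + t := by
  classical
  rw [edgeSkew_apply, edgeSkew_apply, coord_add_smul_edge, coord_add_smul_edge]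
  simp [hij, hij.symm]; ring

lemma edgeSwap_eq_add (x : E) : edgeSwap b i j x =
    x + (-(edgeHeight b i j x + edgeSkew b i j x)) • (b i - b j) := by
  rw [edgeSwap_apply, neg_smul, sub_eq_add_neg]

lemma edgeHeight_edgeSwap (hij : i ≠ j) (x : E) :
    edgeHeight b i j (edgeSwap b i j x) = -edgeSkew b i j x := by
  rw [edgeSwap_eq_add, edgeHeight_add_smul_edge b hij]; ring

lemma edgeSkew_edgeSwap (hij : i ≠ j) (x : E) :
    edgeSkew b i j (edgeSwap b i j x) = -edgeHeight b i j x := by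
  rw [edgeSwap_eq_add, edgeSkew_add_smul_edge b hij]; ring

lemma edgeSwap_involutive (hij : i ≠ j) : Function.Involutive (edgeSwap b i j) := by
  intro x
  rw [edgeSwap_eq_add b (edgeSwap b i j x), edgeHeight_edgeSwap b hij, edgeSkew_edgeSwap b hij,
    edgeSwap_apply]
  module

lemma norm_sq_add_smul_edge (hij : i ≠ j) (x : E) (t : ℝ) :
    ‖x + t • (b i - b j)‖ ^ 2 =
      ‖x‖ ^ 2 + ((edgeHeight b i j x + t) ^ 2 - edgeHeight b i j x ^ 2) * ‖b i - b j‖ ^ 2 := by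
  rw [norm_add_sq_real, real_inner_smul_right, real_inner_comm, inner_edge b hij, norm_smul,
    mul_pow, Real.norm_eq_abs, sq_abs]
  ring

lemma norm_sq_edgeSwap (hij : i ≠ j) (x : E) :
    ‖edgeSwap b i j x‖ ^ 2 =
      ‖x‖ ^ 2 + (edgeSkew b i j x ^ 2 - edgeHeight b i j x ^ 2) * ‖b i - b j‖ ^ 2 := by
  rw [edgeSwap_eq_add, norm_sq_add_smul_edge b hij]; ring

/-- Half the length, in units of the edge, of the chord of the simplex through `x` parallel to
the edge. -/
noncomputable def edgeHalfWidth (b : AffineBasis ι ℝ E) (i j : ι) (x : E) : ℝ :=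
  (b.coord i x + b.coord j x) / 2

lemma edgeHalfWidth_add_smul_edge (hij : i ≠ j) (x : E) (t : ℝ) :
    edgeHalfWidth b i j (x + t • (b i - b j)) = edgeHalfWidth b i j x := by
  classical
  rw [edgeHalfWidth, edgeHalfWidth, coord_add_smul_edge, coord_add_smul_edge]
  simp only [hij, hij.symm, if_true, if_false]; ring

lemma coord_add_smul_edge_of_ne {k : ι} (hki : k ≠ i) (hkj : k ≠ j) (x : E) (t : ℝ) :
    b.coord k (x + t • (b i - b j)) = b.coord k x := by
  classical
  rw [coord_add_smul_edge]; simp [hki, hkj]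

/-- The simplex, described chord by chord along an edge direction. -/
lemma mem_convexHull_iff_edgeSkew [Finite ι] (x : E) :
    x ∈ convexHull ℝ (Set.range b) ↔
      (∀ k, k ≠ i → k ≠ j → 0 ≤ b.coord k x) ∧ |edgeSkew b i j x| ≤ edgeHalfWidth b i j x := by
  cases nonempty_fintype ι
  rw [b.convexHull_eq_nonneg_coord, Set.mem_ofPred, abs_le, edgeSkew_apply, edgeHalfWidth]
  constructor
  · intro h
    have := h i
    have := h j
    exact ⟨fun k _ _ => h k, by linarith, by linarith⟩
  · rintro ⟨h, h1, h2⟩ k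
    by_cases hi : k = i
    · subst hi; linarith
    by_cases hj : k = j
    · subst hj; linarith
    exact h k hi hj

lemma range_edgeSwap_comp_convexHull :
    convexHull ℝ (Set.range (edgeSwap b i j ∘ b)) =
      edgeSwap b i j '' convexHull ℝ (Set.range b) := by
  rw [Set.range_comp, AffineMap.image_convexHull]

lemma mem_symmetral_iff_edgeSwap_mem (hij : i ≠ j) (x : E) :
    x ∈ convexHull ℝ (Set.range (edgeSwap b i j ∘ b)) ↔
      edgeSwap b i j x ∈ convexHull ℝ (Set.range b) := by
  rw [range_edgeSwap_comp_convexHull]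
  exact ⟨by rintro ⟨y, hy, rfl⟩; rwa [edgeSwap_involutive b hij],
    fun h => ⟨_, h, edgeSwap_involutive b hij x⟩⟩

/-- The Steiner symmetral of the simplex, described chord by chord along the edge direction. -/
lemma mem_symmetral_iff_edgeHeight [Finite ι] (hij : i ≠ j) (x : E) :
    x ∈ convexHull ℝ (Set.range (edgeSwap b i j ∘ b)) ↔
      (∀ k, k ≠ i → k ≠ j → 0 ≤ b.coord k x) ∧
        |edgeHeight b i j x| ≤ edgeHalfWidth b i j x := by
  rw [mem_symmetral_iff_edgeSwap_mem b hij, mem_convexHull_iff_edgeSkew b (i := i) (j := j),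
    edgeSkew_edgeSwap b hij, abs_neg]
  refine and_congr (forall_congr' fun k => forall_congr' fun hi => forall_congr' fun hj => ?_) ?_
  · rw [edgeSwap_eq_add, coord_add_smul_edge_of_ne b hi hj]
  · rw [edgeSwap_eq_add, edgeHalfWidth_add_smul_edge b hij]

/-- Points that the simplex loses under symmetrization are replaced by points closer to the
origin. -/
lemma norm_edgeSwap_lt [Finite ι] (hij : i ≠ j) {x : E} (hx : x ∈ convexHull ℝ (Set.range b))
    (hx' : x ∉ convexHull ℝ (Set.range (edgeSwap b i j ∘ b))) :
    ‖edgeSwap b i j x‖ < ‖x‖ := by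
  rw [mem_convexHull_iff_edgeSkew b (i := i) (j := j)] at hx
  rw [mem_symmetral_iff_edgeHeight b hij] at hx'
  have hlt : edgeHalfWidth b i j x < |edgeHeight b i j x| := by
    by_contra h; exact hx' ⟨hx.1, not_lt.1 h⟩
  have hsq := sq_lt_sq.2 (hx.2.trans_lt hlt)
  have hu : 0 < ‖b i - b j‖ ^ 2 := by have := norm_pos_iff.2 (edge_ne_zero b hij); positivity
  refine lt_of_pow_lt_pow_left₀ 2 (norm_nonneg _) ?_
  rw [norm_sq_edgeSwap b hij]
  nlinarith

lemma edgeSkew_left (hij : i ≠ j) : edgeSkew b i j (b i) = 1 / 2 := by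
  classical
  rw [edgeSkew_apply, b.coord_apply, b.coord_apply]; simp [hij.symm]

lemma edgeSkew_right (hij : i ≠ j) : edgeSkew b i j (b j) = -1 / 2 := by
  classical
  rw [edgeSkew_apply, b.coord_apply, b.coord_apply]; simp [hij]

lemma edgeSkew_of_ne {k : ι} (hki : k ≠ i) (hkj : k ≠ j) : edgeSkew b i j (b k) = 0 := by
  classical
  rw [edgeSkew_apply, b.coord_apply, b.coord_apply]; simp [hki.symm, hkj.symm]

lemma edgeHeight_left (hij : i ≠ j) : edgeHeight b i j (b i) = edgeHeight b i j (b j) + 1 := by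
  have := edgeHeight_edge b hij
  rw [map_sub] at this; linarith

/-- The edge from `b j` to `b i` is balanced when the hyperplane through the origin orthogonal to
it bisects it and contains all other vertices. -/
def IsEdgeBalanced (p : ι → E) (i j : ι) : Prop :=
  ‖p i‖ = ‖p j‖ ∧ ∀ k, k ≠ i → k ≠ j → ⟪p i - p j, p k⟫ = 0

lemma isEdgeBalanced_iff (hij : i ≠ j) : IsEdgeBalanced b i j ↔
    edgeHeight b i j (b i) = 1 / 2 ∧ ∀ k, k ≠ i → k ≠ j → edgeHeight b i j (b k) = 0 := by
  have hu : 0 < ‖b i - b j‖ ^ 2 := by have := norm_pos_iff.2 (edge_ne_zero b hij); positivity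
  refine and_congr ?_ (forall_congr' fun k => forall_congr' fun hi => forall_congr' fun hj => ?_)
  · have h1 := norm_sq_add_smul_edge b hij (b j) 1
    have h2 := edgeHeight_left b hij
    rw [one_smul, add_sub_cancel] at h1
    constructor
    · intro h
      rw [h] at h1
      have : ((edgeHeight b i j (b j) + 1) ^ 2 - edgeHeight b i j (b j) ^ 2) = 0 := by
        have : ((edgeHeight b i j (b j) + 1) ^ 2 - edgeHeight b i j (b j) ^ 2) *
          ‖b i - b j‖ ^ 2 = 0 := by linarith
        exact (mul_eq_zero.1 this).resolve_right hu.ne'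
      linarith
    · intro h
      have : edgeHeight b i j (b j) = -1 / 2 := by linarith
      rw [this] at h1
      norm_num at h1
      exact h1
  · rw [inner_edge b hij, mul_eq_zero, or_iff_left hu.ne']

/-- Symmetrization lowers the sum of the squared distances of the vertices from the origin, unless
the edge is balanced already. -/
lemma sum_norm_sq_edgeSwap_lt [Fintype ι] (hij : i ≠ j) (hb : ¬ IsEdgeBalanced b i j) :
    ∑ k, ‖edgeSwap b i j (b k)‖ ^ 2 < ∑ k, ‖b k‖ ^ 2 := by
  classical
  have hu : 0 < ‖b i - b j‖ ^ 2 := by have := norm_pos_iff.2 (edge_ne_zero b hij); positivity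
  simp_rw [norm_sq_edgeSwap b hij, Finset.sum_add_distrib, ← Finset.sum_mul]
  rw [isEdgeBalanced_iff b hij] at hb
  suffices ∑ k, (edgeSkew b i j (b k) ^ 2 - edgeHeight b i j (b k) ^ 2) < 0 by nlinarith
  rw [← Finset.add_sum_erase _ _ (Finset.mem_univ i),
    ← Finset.add_sum_erase _ _ (Finset.mem_erase.2 ⟨hij.symm, Finset.mem_univ j⟩), ← add_assoc]
  have hrest : ∀ k ∈ (Finset.univ.erase i).erase j,
      edgeSkew b i j (b k) ^ 2 - edgeHeight b i j (b k) ^ 2 = - edgeHeight b i j (b k) ^ 2 := by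
    intro k hk
    simp only [Finset.mem_erase] at hk
    rw [edgeSkew_of_ne b hk.2.1 hk.1]; ring
  rw [Finset.sum_congr rfl hrest, edgeSkew_left b hij, edgeSkew_right b hij,
    edgeHeight_left b hij, Finset.sum_neg_distrib]
  have h0 : 0 ≤ ∑ k ∈ (Finset.univ.erase i).erase j, edgeHeight b i j (b k) ^ 2 :=
    Finset.sum_nonneg fun _ _ => sq_nonneg _
  have hdir : (1 / 2 : ℝ) ^ 2 - (edgeHeight b i j (b j) + 1) ^ 2 +
      ((-1 / 2) ^ 2 - edgeHeight b i j (b j) ^ 2) = -2 * (edgeHeight b i j (b j) + 1 / 2) ^ 2 := by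
    ring
  rw [hdir]
  by_contra hcon
  have hs := sq_nonneg (edgeHeight b i j (b j) + 1 / 2)
  have e1 : (edgeHeight b i j (b j) + 1 / 2) ^ 2 = 0 := by linarith
  have e2 : ∑ k ∈ (Finset.univ.erase i).erase j, edgeHeight b i j (b k) ^ 2 = 0 := by linarith
  refine hb ⟨?_, fun k hi hj => ?_⟩
  · have := pow_eq_zero_iff (two_ne_zero) |>.1 e1
    rw [edgeHeight_left b hij]; linarith
  · rw [Finset.sum_eq_zero_iff_of_nonneg fun _ _ => sq_nonneg _] at e2
    exact pow_eq_zero_iff two_ne_zero |>.1 (e2 k (by simp [hi, hj]))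

/-- If the edge is not balanced, some vertex is lost under symmetrization. -/
lemma exists_vertex_notMem_symmetral [Finite ι] (hij : i ≠ j) (hb : ¬ IsEdgeBalanced b i j) :
    ∃ k, b k ∉ convexHull ℝ (Set.range (edgeSwap b i j ∘ b)) := by
  classical
  by_contra! h
  simp_rw [mem_symmetral_iff_edgeHeight b hij] at h
  refine hb ((isEdgeBalanced_iff b hij).2 ⟨?_, fun k hi hj => ?_⟩)
  · have h1 := (h i).2
    have h2 := (h j).2
    simp only [edgeHalfWidth, b.coord_apply, hij, hij.symm, if_true, if_false, abs_le] at h1 h2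
    rw [edgeHeight_left b hij] at h1 ⊢
    linarith
  · have h1 := (h k).2
    simp only [edgeHalfWidth, b.coord_apply, hi.symm, hj.symm, if_false, add_zero, zero_div] at h1
    exact abs_eq_zero.1 (le_antisymm h1 (abs_nonneg _))

/-- Symmetrizing a ball that contains the simplex gives a ball that contains the symmetral. -/
lemma exists_symmetral_subset_closedBall [Finite ι] (hij : i ≠ j) {c : E} {r : ℝ}
    (h : convexHull ℝ (Set.range b) ⊆ Metric.closedBall c r) :
    ∃ c', convexHull ℝ (Set.range (edgeSwap b i j ∘ b)) ⊆ Metric.closedBall c' r := by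
  set u := b i - b j with hu
  refine ⟨c + (-edgeHeight b i j c) • u, ?_⟩
  rw [range_edgeSwap_comp_convexHull]
  rintro _ ⟨x, hx, rfl⟩
  -- `y` is the mirror image of `x` in the midpoint of its chord.
  have hy : x + (-(2 * edgeSkew b i j x)) • u ∈ convexHull ℝ (Set.range b) := by
    rw [mem_convexHull_iff_edgeSkew b (i := i) (j := j)] at hx ⊢
    refine ⟨fun k hi hj => ?_, ?_⟩
    · rw [coord_add_smul_edge_of_ne b hi hj]; exact hx.1 k hi hj
    · rw [edgeHalfWidth_add_smul_edge b hij, edgeSkew_add_smul_edge b hij]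
      convert hx.2 using 1
      rw [← abs_neg]; congr 1; ring
  have h1 := h hx
  have h2 := h hy
  rw [mem_closedBall_iff_norm] at h1 h2 ⊢
  have hr : 0 ≤ r := (norm_nonneg _).trans h1
  rw [← abs_of_nonneg hr] at h1 h2 ⊢
  rw [← abs_norm, ← sq_le_sq] at h1 h2 ⊢
  have e2 : x + (-(2 * edgeSkew b i j x)) • u - c = (x - c) + (-(2 * edgeSkew b i j x)) • u := by
    module
  have e3 : edgeSwap b i j x - (c + (-edgeHeight b i j c) • u) =
      (x - c) + (-(edgeHeight b i j (x - c) + edgeSkew b i j x)) • u := by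
    rw [edgeSwap_apply, map_sub]; module
  rw [e2, norm_sq_add_smul_edge b hij] at h2
  rw [e3, norm_sq_add_smul_edge b hij]
  have hpos : 0 ≤ ‖b i - b j‖ ^ 2 := by positivity
  rcases le_total (edgeSkew b i j x ^ 2) (edgeHeight b i j (x - c) ^ 2) with h3 | h3
  · nlinarith
  · have h4 : edgeSkew b i j x ^ 2 ≤ (edgeHeight b i j (x - c) + -(2 * edgeSkew b i j x)) ^ 2 := by
      rw [sq_le_sq] at h3 ⊢
      have := abs_sub_abs_le_abs_sub (2 * edgeSkew b i j x) (edgeHeight b i j (x - c))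
      rw [abs_mul, abs_two, ← abs_neg (2 * _ - _)] at this
      have e : -(2 * edgeSkew b i j x - edgeHeight b i j (x - c)) =
        edgeHeight b i j (x - c) + -(2 * edgeSkew b i j x) := by ring
      rw [e] at this
      linarith
    nlinarith

/-- Symmetrizing a ball contained in the simplex gives a ball contained in the symmetral. -/
lemma exists_closedBall_subset_symmetral [Finite ι] (hij : i ≠ j) {c : E} {r : ℝ}
    (h : Metric.closedBall c r ⊆ convexHull ℝ (Set.range b)) :
    ∃ c', Metric.closedBall c' r ⊆ convexHull ℝ (Set.range (edgeSwap b i j ∘ b)) := by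
  set u := b i - b j with hu
  refine ⟨c + (-edgeHeight b i j c) • u, fun z hz => ?_⟩
  -- `c + w` and `c + w'` lie on the chord through `z`, where `w'` is the mirror image of `w`
  -- in the hyperplane through the origin orthogonal to the edge.
  set w := z - (c + (-edgeHeight b i j c) • u) with hw
  have hwz : edgeHeight b i j w = edgeHeight b i j z := by
    rw [hw, map_sub, edgeHeight_add_smul_edge b hij]; ring
  have hz' : ‖w‖ ≤ r := mem_closedBall_iff_norm.1 hz
  have h1 : c + w ∈ convexHull ℝ (Set.range b) :=
    h (mem_closedBall_iff_norm.2 (by rwa [add_sub_cancel_left]))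
  have h2 : c + (w + (-(2 * edgeHeight b i j z)) • u) ∈ convexHull ℝ (Set.range b) := by
    refine h (mem_closedBall_iff_norm.2 ?_)
    rw [add_sub_cancel_left]
    refine le_trans (le_of_eq ?_) hz'
    rw [← sq_eq_sq₀ (norm_nonneg _) (norm_nonneg _), norm_sq_add_smul_edge b hij, hwz]
    ring
  have e1 : c + w = z + edgeHeight b i j c • u := by rw [hw]; module
  have e2 : c + (w + (-(2 * edgeHeight b i j z)) • u) =
      z + (edgeHeight b i j c - 2 * edgeHeight b i j z) • u := by rw [hw]; module
  rw [e1, mem_convexHull_iff_edgeSkew b (i := i) (j := j), edgeSkew_add_smul_edge b hij,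
    edgeHalfWidth_add_smul_edge b hij] at h1
  rw [e2, mem_convexHull_iff_edgeSkew b (i := i) (j := j), edgeSkew_add_smul_edge b hij,
    edgeHalfWidth_add_smul_edge b hij] at h2
  rw [mem_symmetral_iff_edgeHeight b hij]
  refine ⟨fun k hi hj => ?_, ?_⟩
  · rw [← coord_add_smul_edge_of_ne b hi hj]; exact h1.1 k hi hj
  · have h3 := abs_le.1 h1.2
    have h4 := abs_le.1 h2.2
    rw [abs_le]; constructor <;> linarith

end EdgeSwap

/-! ### Integrals over sets exchanged by an involution -/

section Exchange

open Set

/-- Comparison of the integrals over two sets exchanged by a measure preserving involution: it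
exchanges `A \ B` and `B \ A`, and the common part `A ∩ B` contributes equally. -/
lemma setLIntegral_le_of_involutive {α : Type*} [MeasurableSpace α] {μ : Measure α} {f : α → α}
    (hf : MeasurePreserving f μ μ) (hinv : Function.Involutive f) {g : α → ENNReal} {A B : Set α}
    (hA : MeasurableSet A) (hB : MeasurableSet B) (hAB : ∀ x, x ∈ B ↔ f x ∈ A)
    (h : ∀ x ∈ A \ B, g x ≤ g (f x)) : ∫⁻ x in A, g x ∂μ ≤ ∫⁻ x in B, g x ∂μ := by
  have hpre : f ⁻¹' (B \ A) = A \ B := by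
    ext x
    simp only [mem_preimage, Set.mem_sdiff, hAB, hinv x]
  have hemb : MeasurableEmbedding f :=
    (⟨hinv.toPerm, hf.measurable, hf.measurable⟩ : α ≃ᵐ α).measurableEmbedding
  rw [← lintegral_inter_add_sdiff g A hB, ← lintegral_inter_add_sdiff g B hA, inter_comm B A,
    ← hf.setLIntegral_comp_preimage_emb hemb g (B \ A), hpre]
  gcongr 1
  exact setLIntegral_mono' (hA.diff hB) h

lemma setLIntegral_lt_of_involutive {α : Type*} [MeasurableSpace α] {μ : Measure α} {f : α → α}
    (hf : MeasurePreserving f μ μ) (hinv : Function.Involutive f) {g : α → ENNReal} {A B : Set α}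
    (hA : MeasurableSet A) (hB : MeasurableSet B) (hAB : ∀ x, x ∈ B ↔ f x ∈ A)
    (hg : Measurable g) (hfin : ∫⁻ x in A, g x ∂μ ≠ ⊤) (hpos : μ (A \ B) ≠ 0)
    (h : ∀ x ∈ A \ B, g x < g (f x)) : ∫⁻ x in A, g x ∂μ < ∫⁻ x in B, g x ∂μ := by
  have hpre : f ⁻¹' (B \ A) = A \ B := by
    ext x
    simp only [mem_preimage, Set.mem_sdiff, hAB, hinv x]
  have hemb : MeasurableEmbedding f :=
    (⟨hinv.toPerm, hf.measurable, hf.measurable⟩ : α ≃ᵐ α).measurableEmbedding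
  have hle : ∀ s ⊆ A, ∫⁻ x in s, g x ∂μ ≠ ⊤ := fun s hs =>
    ((lintegral_mono_set hs).trans_lt hfin.lt_top).ne
  rw [← lintegral_inter_add_sdiff g A hB, ← lintegral_inter_add_sdiff g B hA, inter_comm B A,
    ← hf.setLIntegral_comp_preimage_emb hemb g (B \ A), hpre]
  exact ENNReal.add_lt_add_left (hle _ inter_subset_left)
    (setLIntegral_strict_mono (hA.diff hB) hpos (hg.comp hf.measurable) (hle _ sdiff_subset)
      (Filter.Eventually.of_forall h))

end Exchange

/-! ### Volume and radial densities under symmetrization -/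

section Volume

lemma isCompact_convexHull_range {ι F : Type*} [Finite ι] [NormedAddCommGroup F]
    [NormedSpace ℝ F] (p : ι → F) : IsCompact (convexHull ℝ (Set.range p)) :=
  (Set.finite_range p).isCompact_convexHull ℝ

lemma interior_convexHull_nonempty {ι F : Type*} [NormedAddCommGroup F] [NormedSpace ℝ F]
    [FiniteDimensional ℝ F] (b : AffineBasis ι ℝ F) :
    (interior (convexHull ℝ (Set.range b))).Nonempty :=
  interior_convexHull_nonempty_iff_affineSpan_eq_top.2 b.tot

lemma measurable_radial {F : Type*} [NormedAddCommGroup F] [MeasurableSpace F] [BorelSpace F]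
    {φ : ℝ → ℝ} (hφ : Antitone φ) :
    Measurable fun x : F => ENNReal.ofReal (φ ‖x‖) :=
  (hφ.measurable.comp measurable_norm).ennreal_ofReal

variable {E : Type*} [NormedAddCommGroup E] [InnerProductSpace ℝ E] [FiniteDimensional ℝ E]
  [MeasurableSpace E] [BorelSpace E]

lemma AffineMap.measurePreserving_of_involutive (f : E →ᵃ[ℝ] E) (hf : Function.Involutive f) :
    MeasurePreserving f (volume : Measure E) volume := by
  have hlin : f.linear ∘ₗ f.linear = LinearMap.id := by
    have h : f.comp f = AffineMap.id ℝ E := by ext x; exact hf x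
    rw [← AffineMap.comp_linear, h, AffineMap.id_linear]
  have hdet : LinearMap.det f.linear * LinearMap.det f.linear = 1 := by
    rw [← LinearMap.det_comp, hlin, LinearMap.det_id]
  have habs : |LinearMap.det f.linear| = 1 := by
    rcases mul_self_eq_one_iff.1 hdet with h | h <;> simp [h]
  have h1 : MeasurePreserving f.linear (volume : Measure E) volume := by
    refine ⟨f.linear.continuous_of_finiteDimensional.measurable, ?_⟩
    rw [Measure.map_linearMap_addHaar_eq_smul_addHaar _ (by intro h; simp [h] at hdet), abs_inv,
      habs]
    simp
  have h2 := (measurePreserving_add_right (volume : Measure E) (f 0)).comp h1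
  have h3 : (fun x => x + f 0) ∘ f.linear = f := by
    ext x; rw [AffineMap.decomp f]; simp
  rwa [h3] at h2

variable {ι : Type*} (b : AffineBasis ι ℝ E) {i j : ι}

lemma measurePreserving_edgeSwap (hij : i ≠ j) :
    MeasurePreserving (edgeSwap b i j) (volume : Measure E) volume :=
  AffineMap.measurePreserving_of_involutive _ (edgeSwap_involutive b hij)

variable [Finite ι]

lemma volume_symmetral (hij : i ≠ j) :
    volume (convexHull ℝ (Set.range (edgeSwap b i j ∘ b))) =
      volume (convexHull ℝ (Set.range b)) := by
  rw [← (measurePreserving_edgeSwap b hij).measure_preimage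
    (isCompact_convexHull_range b).measurableSet.nullMeasurableSet]
  congr 1
  ext x
  exact mem_symmetral_iff_edgeSwap_mem b hij x

lemma lintegral_le_symmetral {φ : ℝ → ℝ} (hφ : Antitone φ) (hij : i ≠ j) :
    ∫⁻ x in convexHull ℝ (Set.range b), ENNReal.ofReal (φ ‖x‖) ≤
      ∫⁻ x in convexHull ℝ (Set.range (edgeSwap b i j ∘ b)), ENNReal.ofReal (φ ‖x‖) :=
  setLIntegral_le_of_involutive (measurePreserving_edgeSwap b hij) (edgeSwap_involutive b hij)
    (isCompact_convexHull_range _).measurableSet (isCompact_convexHull_range _).measurableSet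
    (mem_symmetral_iff_edgeSwap_mem b hij)
    fun _ hx => ENNReal.ofReal_le_ofReal (hφ (norm_edgeSwap_lt b hij hx.1 hx.2).le)

/-- If the edge is not balanced, a set of positive volume is lost under symmetrization, namely the
part of the simplex near some vertex. -/
lemma volume_diff_symmetral_ne_zero (hij : i ≠ j) (hb : ¬ IsEdgeBalanced b i j) :
    volume (convexHull ℝ (Set.range b) \ convexHull ℝ (Set.range (edgeSwap b i j ∘ b))) ≠ 0 := by
  obtain ⟨k, hk⟩ := exists_vertex_notMem_symmetral b hij hb
  have hcl : b k ∈ closure (interior (convexHull ℝ (Set.range b))) := by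
    rw [(convex_convexHull ℝ _).closure_interior_eq_closure_of_nonempty_interior
      (interior_convexHull_nonempty b)]
    exact subset_closure (subset_convexHull ℝ _ (Set.mem_range_self k))
  have hopen := (isCompact_convexHull_range (edgeSwap b i j ∘ b)).isClosed.isOpen_compl
  obtain ⟨y, hy, hy'⟩ := mem_closure_iff.1 hcl _ hopen hk
  have hpos : 0 < volume ((convexHull ℝ (Set.range (edgeSwap b i j ∘ b)))ᶜ ∩
      interior (convexHull ℝ (Set.range b))) :=
    (hopen.inter isOpen_interior).measure_pos volume ⟨y, hy, hy'⟩
  refine (hpos.trans_le (measure_mono ?_)).ne'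
  exact fun x hx => ⟨interior_subset hx.2, hx.1⟩

lemma lintegral_convexHull_ne_top {φ : ℝ → ℝ} {C : ℝ} (hC : ∀ t, φ t ≤ C) (p : ι → E) :
    ∫⁻ x in convexHull ℝ (Set.range p), ENNReal.ofReal (φ ‖x‖) ≠ ⊤ := by
  refine ((lintegral_mono (g := fun _ => ENNReal.ofReal C)
    fun x => ENNReal.ofReal_le_ofReal (hC _)).trans_lt ?_).ne
  rw [setLIntegral_const]
  exact ENNReal.mul_lt_top ENNReal.ofReal_lt_top (isCompact_convexHull_range p).measure_lt_top

lemma lintegral_lt_symmetral {φ : ℝ → ℝ} (hφ : Antitone φ) {C : ℝ} (hC : ∀ t, φ t ≤ C) {m : ℝ}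
    (h0 : ∀ t, 0 ≤ φ t) (hm : StrictAntiOn φ (Set.Icc 0 m))
    (hbm : convexHull ℝ (Set.range b) ⊆ Metric.closedBall 0 m)
    (hij : i ≠ j) (hb : ¬ IsEdgeBalanced b i j) :
    ∫⁻ x in convexHull ℝ (Set.range b), ENNReal.ofReal (φ ‖x‖) <
      ∫⁻ x in convexHull ℝ (Set.range (edgeSwap b i j ∘ b)), ENNReal.ofReal (φ ‖x‖) := by
  refine setLIntegral_lt_of_involutive (measurePreserving_edgeSwap b hij)
    (edgeSwap_involutive b hij)
    (isCompact_convexHull_range _).measurableSet (isCompact_convexHull_range _).measurableSet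
    (mem_symmetral_iff_edgeSwap_mem b hij) (measurable_radial hφ)
    (lintegral_convexHull_ne_top hC _) (volume_diff_symmetral_ne_zero b hij hb) fun x hx => ?_
  have hlt := norm_edgeSwap_lt b hij hx.1 hx.2
  have hxm : ‖x‖ ≤ m := mem_closedBall_zero_iff.1 (hbm hx.1)
  have := hm ⟨norm_nonneg _, hlt.le.trans hxm⟩ ⟨norm_nonneg _, hxm⟩ hlt
  exact (ENNReal.ofReal_lt_ofReal_iff ((h0 _).trans_lt this)).2 this

end Volume

/-! ### Circumradius and inradius -/

section Radii

variable {d : ℕ}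

local notation "E" => EuclideanSpace ℝ (Fin d)

lemma bddBelow_outerRadius (P : Set E) :
    BddBelow {r : ℝ | 0 ≤ r ∧ ∃ c, P ⊆ Metric.closedBall c r} := ⟨0, fun _ h => h.1⟩

lemma outerRadius_le {P : Set E} {c : E} {r : ℝ} (hr : 0 ≤ r) (h : P ⊆ Metric.closedBall c r) :
    outerRadius P ≤ r :=
  csInf_le (bddBelow_outerRadius P) ⟨hr, c, h⟩

lemma exists_subset_closedBall_of_outerRadius_lt {P : Set E} (hP : Bornology.IsBounded P) {r : ℝ}
    (h : outerRadius P < r) : ∃ c, P ⊆ Metric.closedBall c r := by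
  obtain ⟨r₀, hr₀⟩ := hP.subset_closedBall (0 : E)
  have hne : {r : ℝ | 0 ≤ r ∧ ∃ c, P ⊆ Metric.closedBall c r}.Nonempty :=
    ⟨max r₀ 0, le_max_right _ _, 0,
      hr₀.trans (Metric.closedBall_subset_closedBall (le_max_left _ _))⟩
  obtain ⟨s, ⟨-, c, hc⟩, hs⟩ := exists_lt_of_csInf_lt hne h
  exact ⟨c, hc.trans (Metric.closedBall_subset_closedBall hs.le)⟩

lemma outerRadius_nonneg (P : Set E) : 0 ≤ outerRadius P := Real.sInf_nonneg fun _ h => h.1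

lemma outerRadius_le_outerRadius_add {P Q : Set E} (hQ : Bornology.IsBounded Q) {ε : ℝ}
    (hε : 0 ≤ ε)
    (h : ∀ c r, Q ⊆ Metric.closedBall c r → ∃ c', P ⊆ Metric.closedBall c' (r + ε)) :
    outerRadius P ≤ outerRadius Q + ε := by
  refine le_of_forall_pos_le_add fun δ hδ => ?_
  obtain ⟨c, hc⟩ := exists_subset_closedBall_of_outerRadius_lt hQ (lt_add_of_pos_right _ hδ)
  obtain ⟨c', hc'⟩ := h _ _ hc
  have := outerRadius_nonneg Q
  have := outerRadius_le (by positivity) hc'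
  linarith

lemma le_of_closedBall_subset_closedBall_zero [Nontrivial E] {c : E} {r M : ℝ} (hr : 0 ≤ r)
    (h : Metric.closedBall c r ⊆ Metric.closedBall 0 M) : r ≤ M := by
  obtain ⟨v, hv⟩ := exists_norm_eq E hr
  have h1 := h (mem_closedBall_iff_norm.2 (by rw [add_sub_cancel_left, hv]) : c + v ∈ _)
  have h2 := h (mem_closedBall_iff_norm.2 (by rw [sub_sub_cancel_left, norm_neg, hv]) : c - v ∈ _)
  rw [mem_closedBall_zero_iff] at h1 h2
  have h3 : (2 : ℝ) * ‖v‖ = ‖(c + v) - (c - v)‖ := by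
    rw [show (c + v) - (c - v) = (2 : ℝ) • v by module, norm_smul]; simp
  have h4 := norm_sub_le (c + v) (c - v)
  linarith

lemma bddAbove_innerRadius [Nontrivial E] {P : Set E} (hP : Bornology.IsBounded P) :
    BddAbove {r : ℝ | 0 ≤ r ∧ ∃ c, Metric.closedBall c r ⊆ P} := by
  obtain ⟨M, hM⟩ := hP.subset_closedBall (0 : E)
  exact ⟨M, fun r ⟨hr, c, hc⟩ => le_of_closedBall_subset_closedBall_zero hr (hc.trans hM)⟩

lemma le_innerRadius [Nontrivial E] {P : Set E} (hP : Bornology.IsBounded P) {c : E} {r : ℝ}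
    (hr : 0 ≤ r) (h : Metric.closedBall c r ⊆ P) : r ≤ innerRadius P :=
  le_csSup (bddAbove_innerRadius hP) ⟨hr, c, h⟩

lemma innerRadius_nonneg (P : Set E) : 0 ≤ innerRadius P := Real.sSup_nonneg fun _ h => h.1

lemma innerRadius_le {P : Set E} {s : ℝ} (hs : 0 ≤ s)
    (h : ∀ c r, 0 ≤ r → Metric.closedBall c r ⊆ P → r ≤ s) : innerRadius P ≤ s :=
  Real.sSup_le (fun _ ⟨hr, c, hc⟩ => h c _ hr hc) hs

/-- A closed convex set loses at most `ε` in the radius of an inscribed ball when it is replaced by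
a set that it approximates from outside up to `ε`. -/
lemma closedBall_subset_of_subset_cthickening {K : Set E} (hK : Convex ℝ K) (hcl : IsClosed K)
    {c : E} {r ε : ℝ} (hε : 0 ≤ ε)
    (h : Metric.closedBall c r ⊆ Metric.cthickening ε K) : Metric.closedBall c (r - ε) ⊆ K := by
  intro x hx
  by_contra hxK
  -- A hyperplane separates `x` from `K`; moving `x` away from it by `ε` leads too far from `K`.
  obtain ⟨f, s, hfK, hfx⟩ := geometric_hahn_banach_closed_point hK hcl hxK
  set v := (InnerProductSpace.toDual ℝ E).symm f with hv
  have hfv (y : E) : f y = ⟪v, y⟫ := by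
    rw [hv, InnerProductSpace.toDual_symm_apply]
  have hv0 : v ≠ 0 := by
    intro h0
    simp only [hfv, h0, inner_zero_left] at hfK hfx
    have hx1 : x + 0 ∈ Metric.cthickening ε K := by
      rw [add_zero]
      exact h (Metric.closedBall_subset_closedBall (by linarith) hx)
    rcases K.eq_empty_or_nonempty with hE | ⟨a, ha⟩
    · simp [hE] at hx1
    · linarith [hfK a ha]
  have hvn : 0 < ‖v‖ := norm_pos_iff.2 hv0
  set z := x + (ε / ‖v‖) • v with hz
  have hzball : z ∈ Metric.closedBall c r := by
    rw [mem_closedBall_iff_norm] at hx ⊢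
    have e : z - c = (x - c) + (ε / ‖v‖) • v := by rw [hz]; abel
    rw [e]
    refine (norm_add_le _ _).trans ?_
    rw [norm_smul, Real.norm_eq_abs, abs_of_nonneg (by positivity), div_mul_cancel₀ _ hvn.ne']
    linarith
  have hzK := h hzball
  have hfz : f z = f x + ε * ‖v‖ := by
    rw [hz, map_add, map_smul, hfv v, real_inner_self_eq_norm_sq, smul_eq_mul]
    field_simp
  -- The distance from `z` to `K` need not be attained; the gap between `s` and `f x` pays for that.
  have hgap : 0 < (f x - s) / ‖v‖ := div_pos (sub_pos.2 hfx) hvn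
  have := Metric.mem_thickening_iff.1
    (Metric.cthickening_subset_thickening' (lt_of_le_of_lt hε (lt_add_of_pos_right ε hgap))
      (lt_add_of_pos_right ε hgap) K hzK)
  obtain ⟨a, ha, hda⟩ := this
  have h1 : f z - f a ≤ ‖v‖ * dist z a := by
    rw [← map_sub, hfv, dist_eq_norm]
    exact real_inner_le_norm _ _
  have h2 : ‖v‖ * dist z a < ‖v‖ * (ε + (f x - s) / ‖v‖) := by gcongr
  have h3 : ‖v‖ * (ε + (f x - s) / ‖v‖) = ε * ‖v‖ + (f x - s) := by field_simp
  linarith [hfK a ha]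

lemma similarity_image_closedBall {t : ℝ} (ht : 0 < t) (f : E ≃ₗᵢ[ℝ] E) (c : E) (r : ℝ) :
    (fun x => f (t • x)) '' Metric.closedBall c r = Metric.closedBall (f (t • c)) (t * r) := by
  ext y
  simp only [Set.mem_image, mem_closedBall_iff_norm]
  have key (x : E) : ‖f (t • x) - f (t • c)‖ = t * ‖x - c‖ := by
    rw [← map_sub, f.norm_map, ← smul_sub, norm_smul, Real.norm_eq_abs, abs_of_pos ht]
  constructor
  · rintro ⟨x, hx, rfl⟩
    rw [key]; gcongr
  · intro hy
    have hy' : f (t • t⁻¹ • f.symm y) = y := by rw [smul_inv_smul₀ ht.ne', f.apply_symm_apply]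
    refine ⟨t⁻¹ • f.symm y, ?_, hy'⟩
    rw [← hy', key] at hy
    exact le_of_mul_le_mul_left hy ht

lemma similarity_injective {t : ℝ} (ht : 0 < t) (f : E ≃ₗᵢ[ℝ] E) :
    Function.Injective fun x => f (t • x) :=
  f.injective.comp (smul_right_injective E ht.ne')

lemma outerRadius_similarity {P : Set E} (hP : Bornology.IsBounded P) {t : ℝ} (ht : 0 < t)
    (f : E ≃ₗᵢ[ℝ] E) : outerRadius ((fun x => f (t • x)) '' P) = t * outerRadius P := by
  have hbdd : Bornology.IsBounded ((fun x => f (t • x)) '' P) := by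
    obtain ⟨r, hr⟩ := hP.subset_closedBall (0 : E)
    rw [← Set.image_subset_image_iff (similarity_injective ht f),
      similarity_image_closedBall ht] at hr
    exact Metric.isBounded_closedBall.subset hr
  refine le_antisymm (le_of_forall_gt fun r hr => ?_) (le_of_forall_gt fun r hr => ?_)
  · rw [← lt_div_iff₀' ht] at hr
    obtain ⟨s, hs, hsr⟩ := exists_between hr
    obtain ⟨c, hc⟩ := exists_subset_closedBall_of_outerRadius_lt hP hs
    rw [← Set.image_subset_image_iff (similarity_injective ht f),
      similarity_image_closedBall ht] at hc
    have h0 : 0 ≤ s := (outerRadius_nonneg _).trans hs.le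
    exact (outerRadius_le (by positivity) hc).trans_lt ((lt_div_iff₀' ht).1 hsr)
  · obtain ⟨s, hs, hsr⟩ := exists_between hr
    obtain ⟨c, hc⟩ := exists_subset_closedBall_of_outerRadius_lt hbdd hs
    have h0 : 0 ≤ s := (outerRadius_nonneg _).trans hs.le
    have e : Metric.closedBall c s =
        (fun x => f (t • x)) '' Metric.closedBall (t⁻¹ • f.symm c) (s / t) := by
      rw [similarity_image_closedBall ht, smul_inv_smul₀ ht.ne', f.apply_symm_apply,
        mul_div_cancel₀ _ ht.ne']
    rw [e, Set.image_subset_image_iff (similarity_injective ht f)] at hc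
    have := outerRadius_le (by positivity) hc
    rw [le_div_iff₀' ht] at this
    exact this.trans_lt hsr

lemma innerRadius_similarity [Nontrivial E] {P : Set E} (hP : IsCompact P) {t : ℝ}
    (ht : 0 < t) (f : E ≃ₗᵢ[ℝ] E) :
    innerRadius ((fun x => f (t • x)) '' P) = t * innerRadius P := by
  have hcont : Continuous fun x => f (t • x) := by fun_prop
  have hnn := innerRadius_nonneg P
  refine le_antisymm (innerRadius_le (by positivity) fun c r hr h => ?_) ?_
  · have e : Metric.closedBall c r =
        (fun x => f (t • x)) '' Metric.closedBall (t⁻¹ • f.symm c) (r / t) := by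
      rw [similarity_image_closedBall ht, smul_inv_smul₀ ht.ne', f.apply_symm_apply,
        mul_div_cancel₀ _ ht.ne']
    rw [e, Set.image_subset_image_iff (similarity_injective ht f)] at h
    have := le_innerRadius hP.isBounded (by positivity) h
    rwa [div_le_iff₀' ht] at this
  · rw [← le_div_iff₀' ht]
    refine innerRadius_le (div_nonneg (innerRadius_nonneg _) ht.le) fun c r hr h => ?_
    rw [← Set.image_subset_image_iff (similarity_injective ht f),
      similarity_image_closedBall ht] at h
    rw [le_div_iff₀' ht]
    exact le_innerRadius (hP.image hcont).isBounded (by positivity) h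

lemma outerRadius_pos {P : Set E} (hP : Bornology.IsBounded P) (hne : P.Nontrivial) :
    0 < outerRadius P := by
  by_contra hcon
  obtain ⟨x, hx, y, hy, hxy⟩ := hne
  have hd : 0 < dist x y := dist_pos.2 hxy
  obtain ⟨c, hc⟩ := exists_subset_closedBall_of_outerRadius_lt hP
    (lt_of_le_of_lt (not_lt.1 hcon) (by positivity : 0 < dist x y / 4))
  have h1 := Metric.mem_closedBall.1 (hc hx)
  have h2 := Metric.mem_closedBall.1 (hc hy)
  have h3 := dist_triangle_right x y c
  linarith

lemma innerRadius_pos [Nontrivial E] {P : Set E} (hP : Bornology.IsBounded P)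
    (hint : (interior P).Nonempty) : 0 < innerRadius P := by
  obtain ⟨x, hx⟩ := hint
  obtain ⟨r, hr, h⟩ := Metric.nhds_basis_closedBall.mem_iff.1 (mem_interior_iff_mem_nhds.1 hx)
  exact hr.trans_le (le_innerRadius hP hr.le h)

end Radii

/-! ### Compactness of the space of simplices -/

section Configurations

open Filter Topology

variable {d : ℕ}

local notation "E" => EuclideanSpace ℝ (Fin d)

/-- The matrix whose columns are the edge vectors of a configuration of `d + 1` points at its first
point. -/
noncomputable def edgeMatrix (p : Fin (d + 1) → E) : Matrix (Fin d) (Fin d) ℝ :=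
  Matrix.of fun k l => (p l.succ - p 0) k

lemma continuous_edgeMatrix_det :
    Continuous fun p : Fin (d + 1) → E => (edgeMatrix p).det := by
  refine Continuous.matrix_det (continuous_matrix fun k l => ?_)
  simp only [edgeMatrix, Matrix.of_apply, PiLp.sub_apply]
  fun_prop

/-- The simplex is an affine image of the standard simplex, so its volume is a constant multiple of
a determinant; this makes the volume a continuous function of the vertices. -/
lemma volume_convexHull_range (p : Fin (d + 1) → E) :
    volume (convexHull ℝ (Set.range p)) = ENNReal.ofReal |(edgeMatrix p).det| *
      volume (convexHull ℝ (Set.range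
        (Fin.cons 0 (EuclideanSpace.basisFun (Fin d) ℝ) : Fin (d + 1) → E))) := by
  let v := (EuclideanSpace.basisFun (Fin d) ℝ).toBasis
  let f : E →ₗ[ℝ] E := Matrix.toLin v v (edgeMatrix p)
  have hf (l : Fin d) : f (EuclideanSpace.basisFun (Fin d) ℝ l) = p l.succ - p 0 := by
    have h := Matrix.toLin_self v v (edgeMatrix p) l
    rw [OrthonormalBasis.coe_toBasis] at h
    rw [h]
    exact v.sum_repr (p l.succ - p 0)
  have hdet : LinearMap.det f = (edgeMatrix p).det := LinearMap.det_toLin v _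
  rw [← hdet, ← Measure.addHaar_image_linearMap, ← measure_preimage_add_right _ (p 0)]
  congr 1
  have h1 : p = fun k => f ((Fin.cons 0 (EuclideanSpace.basisFun (Fin d) ℝ) :
      Fin (d + 1) → E) k) + p 0 := by
    ext1 k
    refine Fin.cases ?_ (fun l => ?_) k
    · simp
    · rw [Fin.cons_succ, hf, sub_add_cancel]
  have h2 : Set.range p = (AffineEquiv.vaddConst ℝ (p 0) : E →ᵃ[ℝ] E) '' (f.toAffineMap ''
      Set.range (Fin.cons 0 (EuclideanSpace.basisFun (Fin d) ℝ) : Fin (d + 1) → E)) := by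
    rw [← Set.range_comp, ← Set.range_comp]
    exact congrArg Set.range h1
  rw [h2, ← AffineMap.image_convexHull, ← AffineMap.image_convexHull]
  ext x
  simp

lemma isClosed_volume_convexHull_eq (v : ENNReal) :
    IsClosed {p : Fin (d + 1) → E | volume (convexHull ℝ (Set.range p)) = v} := by
  refine isClosed_eq ?_ continuous_const
  rw [funext volume_convexHull_range]
  refine ENNReal.continuous_mul_const (isCompact_convexHull_range _).measure_lt_top.ne |>.comp ?_
  exact ENNReal.continuous_ofReal.comp continuous_edgeMatrix_det.abs

lemma convexHull_range_subset_cthickening {ι : Type*} [Fintype ι] (p q : ι → E) {ε : ℝ}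
    (h : dist p q ≤ ε) :
    convexHull ℝ (Set.range p) ⊆ Metric.cthickening ε (convexHull ℝ (Set.range q)) := by
  refine convexHull_min ?_ ((convex_convexHull ℝ _).cthickening ε)
  rintro _ ⟨k, rfl⟩
  exact Metric.mem_cthickening_of_dist_le _ (q k) _ _
    (subset_convexHull ℝ _ (Set.mem_range_self k)) ((dist_le_pi_dist p q k).trans h)

/-- The measure of the convex hull is an upper semicontinuous function of the points. -/
lemma isClosed_le_measure_convexHull {ι : Type*} [Fintype ι] (μ : Measure E)
    [IsFiniteMeasureOnCompacts μ] (v : ENNReal) :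
    IsClosed {p : ι → E | v ≤ μ (convexHull ℝ (Set.range p))} := by
  refine isClosed_of_closure_subset fun q hq => ?_
  have hlim := (tendsto_measure_cthickening_of_isCompact (μ := μ)
    (isCompact_convexHull_range q)).mono_left (nhdsWithin_le_nhds (s := Set.Ioi 0))
  refine ge_of_tendsto hlim (eventually_nhdsWithin_of_forall fun ε hε => ?_)
  obtain ⟨p, hp, hpq⟩ := Metric.mem_closure_iff.1 hq ε hε
  rw [dist_comm] at hpq
  exact le_trans hp (measure_mono (convexHull_range_subset_cthickening p q hpq.le))

lemma isClosed_outerRadius_le {ι : Type*} [Fintype ι] (R : ℝ) :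
    IsClosed {p : ι → E | outerRadius (convexHull ℝ (Set.range p)) ≤ R} := by
  refine isClosed_of_closure_subset fun q hq => Set.mem_ofPred.2 <|
    le_of_forall_pos_le_add fun ε hε => ?_
  obtain ⟨p, hp, hpq⟩ := Metric.mem_closure_iff.1 hq ε hε
  refine (outerRadius_le_outerRadius_add (isCompact_convexHull_range p).isBounded hε.le
    fun c r h => ⟨c, ?_⟩).trans (add_le_add_left hp ε)
  refine convexHull_min ?_ (convex_closedBall _ _)
  rintro _ ⟨k, rfl⟩
  have h1 := Metric.mem_closedBall.1 (h (subset_convexHull ℝ _ (Set.mem_range_self k)))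
  have h2 := dist_triangle (q k) (p k) c
  have h3 := dist_le_pi_dist q p k
  exact Metric.mem_closedBall.2 (by linarith)

lemma isClosed_le_innerRadius [Nontrivial E] {ι : Type*} [Fintype ι] (R : ℝ) :
    IsClosed {p : ι → E | R ≤ innerRadius (convexHull ℝ (Set.range p))} := by
  refine isClosed_of_closure_subset fun q hq => Set.mem_ofPred.2 <|
    le_of_forall_pos_le_add fun ε hε => ?_
  obtain ⟨p, hp, hpq⟩ := Metric.mem_closure_iff.1 hq ε hε
  refine le_trans hp ?_
  have h0 := innerRadius_nonneg (convexHull ℝ (Set.range q))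
  refine innerRadius_le (by positivity) fun c r hr h => ?_
  have h1 := closedBall_subset_of_subset_cthickening (convex_convexHull ℝ _)
    (isCompact_convexHull_range q).isClosed hε.le
    (h.trans (convexHull_range_subset_cthickening p q (by rw [dist_comm]; exact hpq.le)))
  rcases le_total r ε with hrε | hrε
  · linarith
  · have := le_innerRadius (isCompact_convexHull_range q).isBounded (sub_nonneg.2 hrε) h1
    linarith

lemma outerRadius_symmetral_le {ι : Type*} [Finite ι] (b : AffineBasis ι ℝ E) {i j : ι}
    (hij : i ≠ j) : outerRadius (convexHull ℝ (Set.range (edgeSwap b i j ∘ b))) ≤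
      outerRadius (convexHull ℝ (Set.range b)) := by
  rw [← add_zero (outerRadius (convexHull ℝ (Set.range b)))]
  refine outerRadius_le_outerRadius_add (isCompact_convexHull_range _).isBounded le_rfl
    fun c r h => ?_
  rw [add_zero]
  exact exists_symmetral_subset_closedBall b hij h

lemma innerRadius_le_symmetral [Nontrivial E] {ι : Type*} [Finite ι] (b : AffineBasis ι ℝ E)
    {i j : ι} (hij : i ≠ j) : innerRadius (convexHull ℝ (Set.range b)) ≤
      innerRadius (convexHull ℝ (Set.range (edgeSwap b i j ∘ b))) := by
  refine innerRadius_le (innerRadius_nonneg _) fun c r hr h => ?_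
  obtain ⟨c', h'⟩ := exists_closedBall_subset_symmetral b hij h
  exact le_innerRadius (isCompact_convexHull_range _).isBounded hr h'

lemma affineSpan_eq_top_of_volume_ne_zero {s : Set E} (h : volume (convexHull ℝ s) ≠ 0) :
    affineSpan ℝ s = ⊤ := by
  by_contra hne
  exact h (measure_mono_null (convexHull_subset_affineSpan s)
    (Measure.addHaar_affineSubspace volume _ hne))

lemma exists_affineBasis_of_volume_ne_zero {p : Fin (d + 1) → E}
    (h : volume (convexHull ℝ (Set.range p)) ≠ 0) :
    ∃ b : AffineBasis (Fin (d + 1)) ℝ E, ⇑b = p := by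
  have htop := affineSpan_eq_top_of_volume_ne_zero h
  have hind : AffineIndependent ℝ p := by
    rw [affineIndependent_iff_finrank_vectorSpan_eq ℝ p (n := d) (by simp),
      ← direction_affineSpan, htop, AffineSubspace.direction_top, finrank_top,
      finrank_euclideanSpace_fin]
  exact ⟨⟨p, hind, htop⟩, rfl⟩

lemma volume_convexHull_ne_zero {ι : Type*} [Finite ι] (b : AffineBasis ι ℝ E) :
    volume (convexHull ℝ (Set.range b)) ≠ 0 :=
  (Measure.measure_pos_of_nonempty_interior _ (interior_convexHull_nonempty b)).ne'

/-- Among the simplices that are at least as good as a given one in all quantities monotone under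
symmetrization there is one all of whose edges are balanced: the one with vertices closest to the
origin in the sense of least squares. -/
theorem exists_balanced_improvement [Nontrivial E] {φ : ℝ → ℝ} (hφ : Antitone φ) {C : ℝ}
    (hC : ∀ t, φ t ≤ C) (b : AffineBasis (Fin (d + 1)) ℝ E) :
    ∃ b' : AffineBasis (Fin (d + 1)) ℝ E, (∀ i j, i ≠ j → IsEdgeBalanced b' i j) ∧
      volume (convexHull ℝ (Set.range b')) = volume (convexHull ℝ (Set.range b)) ∧
      ∫⁻ x in convexHull ℝ (Set.range b), ENNReal.ofReal (φ ‖x‖) ≤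
        ∫⁻ x in convexHull ℝ (Set.range b'), ENNReal.ofReal (φ ‖x‖) ∧
      outerRadius (convexHull ℝ (Set.range b')) ≤ outerRadius (convexHull ℝ (Set.range b)) ∧
      innerRadius (convexHull ℝ (Set.range b)) ≤ innerRadius (convexHull ℝ (Set.range b')) := by
  set μ : Measure E := volume.withDensity fun x => ENNReal.ofReal (φ ‖x‖) with hμ
  have hμK {ι : Type} [Finite ι] (p : ι → E) : μ (convexHull ℝ (Set.range p)) =
      ∫⁻ x in convexHull ℝ (Set.range p), ENNReal.ofReal (φ ‖x‖) :=
    withDensity_apply _ (isCompact_convexHull_range p).measurableSet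
  have : IsFiniteMeasureOnCompacts μ := by
    refine ⟨fun K hK => ?_⟩
    rw [hμ, withDensity_apply _ hK.measurableSet]
    refine (lintegral_mono (g := fun _ => ENNReal.ofReal C)
      fun x => ENNReal.ofReal_le_ofReal (hC _)).trans_lt ?_
    rw [setLIntegral_const]
    exact ENNReal.mul_lt_top ENNReal.ofReal_lt_top hK.measure_lt_top
  let energy : (Fin (d + 1) → E) → ℝ := fun p => ∑ k, ‖p k‖ ^ 2
  have henergy : Continuous energy := by fun_prop
  let A : Set (Fin (d + 1) → E) :=
    {p | volume (convexHull ℝ (Set.range p)) = volume (convexHull ℝ (Set.range b))} ∩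
    {p | μ (convexHull ℝ (Set.range b)) ≤ μ (convexHull ℝ (Set.range p))} ∩
    {p | outerRadius (convexHull ℝ (Set.range p)) ≤ outerRadius (convexHull ℝ (Set.range b))} ∩
    {p | innerRadius (convexHull ℝ (Set.range b)) ≤ innerRadius (convexHull ℝ (Set.range p))} ∩
    {p | energy p ≤ energy b}
  have hclosed : IsClosed A :=
    ((((isClosed_volume_convexHull_eq _).inter (isClosed_le_measure_convexHull _ _)).inter
      (isClosed_outerRadius_le _)).inter (isClosed_le_innerRadius _)).inter
      (isClosed_le henergy continuous_const)
  have hbdd : A ⊆ Metric.closedBall 0 (√(energy b)) := by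
    rintro p ⟨-, hp⟩
    rw [mem_closedBall_zero_iff, pi_norm_le_iff_of_nonneg (Real.sqrt_nonneg _)]
    intro k
    refine Real.le_sqrt_of_sq_le (le_trans ?_ hp)
    exact Finset.single_le_sum (f := fun k => ‖p k‖ ^ 2) (fun _ _ => sq_nonneg _)
      (Finset.mem_univ k)
  have hcomp : IsCompact A := (isCompact_closedBall _ _).of_isClosed_subset hclosed hbdd
  have hbA : ⇑b ∈ A := by
    refine ⟨⟨⟨⟨?_, ?_⟩, ?_⟩, ?_⟩, ?_⟩ <;> simp only [Set.mem_ofPred, le_refl]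
  obtain ⟨q, ⟨⟨⟨⟨hq1, hq2⟩, hq3⟩, hq4⟩, hq5⟩, hqmin⟩ := hcomp.exists_isMinOn
    ⟨b, hbA⟩ henergy.continuousOn
  obtain ⟨b', rfl⟩ := exists_affineBasis_of_volume_ne_zero (p := q)
    (hq1.trans_ne (volume_convexHull_ne_zero b))
  refine ⟨b', fun i j hij => ?_, hq1, ?_, hq3, hq4⟩
  · by_contra hb
    have hlt : energy (edgeSwap b' i j ∘ b') < energy b' := sum_norm_sq_edgeSwap_lt b' hij hb
    refine hlt.not_ge (hqmin ⟨⟨⟨⟨?_, ?_⟩, ?_⟩, ?_⟩, ?_⟩)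
    · exact (volume_symmetral b' hij).trans hq1
    · refine le_trans (Set.mem_ofPred.1 hq2) ?_
      rw [hμK, hμK]
      exact lintegral_le_symmetral b' hφ hij
    · exact (outerRadius_symmetral_le b' hij).trans hq3
    · exact le_trans (Set.mem_ofPred.1 hq4) (innerRadius_le_symmetral b' hij)
    · exact hlt.le.trans hq5
  · rw [← hμK, ← hμK]; exact hq2

end Configurations

/-! ### Centred regular simplices -/

section CentredRegular

variable {d : ℕ}

local notation "E" => EuclideanSpace ℝ (Fin d)

/-- The vertices of a regular simplex centred at the origin, described by their Gram matrix up to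
the factor `a`, the squared distance of the vertices from the origin. -/
def IsCentredRegular (p : Fin (d + 1) → E) (a : ℝ) : Prop :=
  ∀ i j, d * ⟪p i, p j⟫ = a * if i = j then (d : ℝ) else -1

lemma eq_zero_of_inner_edge_eq_zero (b : AffineBasis (Fin (d + 1)) ℝ E) (v : E)
    (h : ∀ i j, i ≠ j → ⟪b i - b j, v⟫ = 0) : v = 0 := by
  have htop : vectorSpan ℝ (Set.range b) = ⊤ := by
    rw [← direction_affineSpan, b.tot, AffineSubspace.direction_top]
  have hmem : v ∈ (vectorSpan ℝ (Set.range b))ᗮ := by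
    rw [vectorSpan_def, Submodule.mem_orthogonal]
    intro u hu
    induction hu using Submodule.span_induction with
    | mem x hx =>
      obtain ⟨_, ⟨i, rfl⟩, _, ⟨j, rfl⟩, rfl⟩ := hx
      by_cases hij : i = j
      · simp [hij]
      · exact h i j hij
    | zero => simp
    | add x y _ _ hx hy => rw [inner_add_left, hx, hy, add_zero]
    | smul t x _ hx => rw [real_inner_smul_left, hx, mul_zero]
  rwa [htop, Submodule.top_orthogonal_eq_bot, Submodule.mem_bot] at hmem

lemma isCentredRegular_of_inner {p : Fin (d + 1) → E} (hsum : ∑ k, p k = 0)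
    (hnorm : ∀ i j, ‖p i‖ = ‖p j‖) (hinner : ∀ i j k, k ≠ i → k ≠ j → ⟪p i, p k⟫ = ⟪p j, p k⟫) :
    IsCentredRegular p (‖p 0‖ ^ 2) := by
  intro i j
  split_ifs with hij
  · rw [hij, real_inner_self_eq_norm_sq, hnorm j 0, mul_comm]
  · have h0 : ∑ k, ⟪p k, p j⟫ = 0 := by rw [← sum_inner, hsum, inner_zero_left]
    rw [← Finset.add_sum_erase _ _ (Finset.mem_univ j), real_inner_self_eq_norm_sq,
      Finset.sum_congr rfl (g := fun _ => ⟪p i, p j⟫) fun k hk => hinner k i j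
        (Finset.ne_of_mem_erase hk).symm (Ne.symm hij)] at h0
    simp only [Finset.sum_const, Finset.card_erase_of_mem (Finset.mem_univ j), Finset.card_univ,
      Fintype.card_fin, Nat.add_sub_cancel, nsmul_eq_mul] at h0
    rw [hnorm j 0] at h0
    linarith

lemma sum_eq_zero_of_isEdgeBalanced (b : AffineBasis (Fin (d + 1)) ℝ E)
    (hb : ∀ i j, i ≠ j → IsEdgeBalanced b i j) : ∑ k, b k = 0 := by
  refine eq_zero_of_inner_edge_eq_zero b _ fun i j hij => ?_
  obtain ⟨hn, ho⟩ := hb i j hij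
  rw [inner_sum, ← Finset.add_sum_erase _ _ (Finset.mem_univ i),
    ← Finset.add_sum_erase _ _ (Finset.mem_erase.2 ⟨hij.symm, Finset.mem_univ j⟩),
    Finset.sum_eq_zero (s := (Finset.univ.erase i).erase j) fun k hk => ?_]
  · rw [inner_sub_left, inner_sub_left, real_inner_self_eq_norm_sq, real_inner_self_eq_norm_sq,
      hn, real_inner_comm (b i) (b j)]
    ring
  · simp only [Finset.mem_erase] at hk
    exact ho k hk.2.1 hk.1

lemma isCentredRegular_of_isEdgeBalanced (b : AffineBasis (Fin (d + 1)) ℝ E)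
    (hb : ∀ i j, i ≠ j → IsEdgeBalanced b i j) : IsCentredRegular b (‖b 0‖ ^ 2) := by
  refine isCentredRegular_of_inner (sum_eq_zero_of_isEdgeBalanced b hb) (fun i j => ?_)
    fun i j k hi hj => ?_
  · by_cases hij : i = j
    · rw [hij]
    · exact (hb i j hij).1
  · by_cases hij : i = j
    · rw [hij]
    · have := (hb i j hij).2 k hi hj
      rwa [inner_sub_left, sub_eq_zero] at this

lemma isCentredRegular_of_equilateral {p : Fin (d + 1) → E} (hsum : ∑ k, p k = 0) {r : ℝ}
    (hr : ∀ i j, i ≠ j → dist (p i) (p j) = r) : IsCentredRegular p (‖p 0‖ ^ 2) := by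
  have hd (i j : Fin (d + 1)) (hij : i ≠ j) :
      r ^ 2 = ‖p i‖ ^ 2 - 2 * ⟪p i, p j⟫ + ‖p j‖ ^ 2 := by
    rw [← hr i j hij, dist_eq_norm, norm_sub_sq_real]
  -- Summing the squared distances from `p i` to all vertices determines `‖p i‖`.
  have hs (i : Fin (d + 1)) : (d : ℝ) * r ^ 2 = (d + 1) * ‖p i‖ ^ 2 + ∑ k, ‖p k‖ ^ 2 := by
    have h1 : ∑ k, (‖p i‖ ^ 2 - 2 * ⟪p i, p k⟫ + ‖p k‖ ^ 2) =
        (d + 1) * ‖p i‖ ^ 2 + ∑ k, ‖p k‖ ^ 2 := by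
      rw [Finset.sum_add_distrib, Finset.sum_sub_distrib, ← Finset.mul_sum, ← inner_sum, hsum]
      simp
    rw [← h1, ← Finset.add_sum_erase _ _ (Finset.mem_univ i),
      Finset.sum_congr rfl (g := fun _ => r ^ 2) fun k hk =>
        (hd i k (Finset.ne_of_mem_erase hk).symm).symm, real_inner_self_eq_norm_sq]
    simp only [Finset.sum_const, Finset.card_erase_of_mem (Finset.mem_univ i), Finset.card_univ,
      Fintype.card_fin, Nat.add_sub_cancel, nsmul_eq_mul]
    ring
  have hn (i j : Fin (d + 1)) : ‖p i‖ = ‖p j‖ := by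
    have h : ((d : ℝ) + 1) * ‖p i‖ ^ 2 = (d + 1) * ‖p j‖ ^ 2 := by linarith [hs i, hs j]
    have h' := mul_left_cancel₀ (by positivity) h
    rwa [sq_eq_sq₀ (norm_nonneg _) (norm_nonneg _)] at h'
  refine isCentredRegular_of_inner hsum hn fun i j k hi hj => ?_
  have h1 := hd i k hi.symm
  have h2 := hd j k hj.symm
  rw [hn i j] at h1
  linarith

/-- The norm of a linear combination of the vertices depends only on the coefficients and `a`. -/
lemma IsCentredRegular.norm_sum_sq {p : Fin (d + 1) → E} {a : ℝ} (hp : IsCentredRegular p a)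
    (w : Fin (d + 1) → ℝ) :
    d * ‖∑ k, w k • p k‖ ^ 2 = a * ∑ i, ∑ j, w i * w j * if i = j then (d : ℝ) else -1 := by
  rw [← real_inner_self_eq_norm_sq, sum_inner, Finset.mul_sum, Finset.mul_sum]
  refine Finset.sum_congr rfl fun i _ => ?_
  rw [inner_sum, Finset.mul_sum, Finset.mul_sum]
  refine Finset.sum_congr rfl fun j _ => ?_
  rw [real_inner_smul_left, real_inner_smul_right]
  linear_combination (w i * w j) * hp i j

lemma IsCentredRegular.pos (hd : 1 ≤ d) {b : AffineBasis (Fin (d + 1)) ℝ E} {a : ℝ}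
    (hb : IsCentredRegular b a) : 0 < a := by
  have hd' : (0 : ℝ) < d := by exact_mod_cast hd
  have h (i : Fin (d + 1)) : ‖b i‖ ^ 2 = a := by
    have := hb i i
    rw [if_pos rfl, real_inner_self_eq_norm_sq, mul_comm] at this
    exact mul_right_cancel₀ hd'.ne' this
  refine lt_of_le_of_ne (by rw [← h 0]; positivity) fun ha => ?_
  have h0 (i : Fin (d + 1)) : b i = 0 := by
    have := h i
    rw [← ha] at this
    exact norm_eq_zero.1 (pow_eq_zero_iff two_ne_zero |>.1 this)
  have hne : (0 : Fin (d + 1)) ≠ Fin.last d := by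
    intro h; have := congrArg Fin.val h; simp at this; omega
  exact hne (b.ind.injective ((h0 0).trans (h0 _).symm))

lemma span_range_affineBasis (b : AffineBasis (Fin (d + 1)) ℝ E) :
    Submodule.span ℝ (Set.range b) = ⊤ := by
  have htop : vectorSpan ℝ (Set.range b) = ⊤ := by
    rw [← direction_affineSpan, b.tot, AffineSubspace.direction_top]
  rw [eq_top_iff, ← htop, vectorSpan_def, Submodule.span_le]
  rintro _ ⟨_, ⟨i, rfl⟩, _, ⟨j, rfl⟩, rfl⟩
  exact Submodule.sub_mem _ (Submodule.subset_span ⟨i, rfl⟩) (Submodule.subset_span ⟨j, rfl⟩)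

/-- Any two regular simplices centred at the origin differ by a linear similarity, since their Gram
matrices are proportional. -/
lemma IsCentredRegular.exists_similarity (hd : 1 ≤ d) {b b' : AffineBasis (Fin (d + 1)) ℝ E}
    {a a' : ℝ} (hb : IsCentredRegular b a) (hb' : IsCentredRegular b' a') :
    ∃ t : ℝ, 0 < t ∧ ∃ f : E ≃ₗᵢ[ℝ] E, ∀ k, b' k = f (t • b k) := by
  have hd' : (0 : ℝ) < d := by exact_mod_cast hd
  have ha := hb.pos hd
  have ha' := hb'.pos hd
  set t := √(a' / a) with ht
  have ht0 : 0 < t := Real.sqrt_pos.2 (div_pos ha' ha)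
  have ht2 : t ^ 2 * a = a' := by
    rw [ht, Real.sq_sqrt (div_pos ha' ha).le, div_mul_cancel₀ _ ha.ne']
  let P : (Fin (d + 1) → ℝ) →ₗ[ℝ] E := t • Fintype.linearCombination ℝ b
  let Q : (Fin (d + 1) → ℝ) →ₗ[ℝ] E := Fintype.linearCombination ℝ b'
  have hPapp (w) : P w = t • ∑ k, w k • b k := by
    simp [P, Fintype.linearCombination_apply]
  have hQapp (w) : Q w = ∑ k, w k • b' k := by simp [Q, Fintype.linearCombination_apply]
  have hPQ (w) : ‖Q w‖ = ‖P w‖ := by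
    rw [← sq_eq_sq₀ (norm_nonneg _) (norm_nonneg _), hPapp, hQapp, norm_smul, mul_pow,
      Real.norm_eq_abs, sq_abs]
    refine mul_left_cancel₀ hd'.ne' ?_
    rw [hb'.norm_sum_sq, mul_left_comm, hb.norm_sum_sq, ← ht2]
    ring
  have hsurj : LinearMap.range P = ⊤ := by
    rw [LinearMap.range_smul _ _ ht0.ne', Fintype.range_linearCombination,
      span_range_affineBasis]
  obtain ⟨s, hs⟩ := P.exists_rightInverse_of_surjective hsurj
  have hs' (x : E) : P (s x) = x := LinearMap.congr_fun hs x
  let f₀ : E →ₗᵢ[ℝ] E := ⟨Q ∘ₗ s, fun x => by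
    rw [LinearMap.comp_apply, hPQ, hs']⟩
  have hf₀ (w) : f₀ (P w) = Q w := by
    change Q (s (P w)) = Q w
    rw [← sub_eq_zero, ← map_sub, ← norm_eq_zero, hPQ, map_sub, hs', sub_self, norm_zero]
  refine ⟨t, ht0, f₀.toLinearIsometryEquiv rfl, fun k => ?_⟩
  have hk := hf₀ (Pi.single k 1)
  rw [hPapp, hQapp] at hk
  simp only [Pi.single_apply, ite_smul, one_smul, zero_smul, Finset.sum_ite_eq',
    Finset.mem_univ, if_true] at hk
  exact hk.symm

lemma convexHull_range_similarity {ι : Type*} {p q : ι → E} {t : ℝ} (f : E ≃ₗᵢ[ℝ] E)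
    (h : ∀ k, q k = f (t • p k)) :
    convexHull ℝ (Set.range q) = (fun x => f (t • x)) '' convexHull ℝ (Set.range p) := by
  have h' : q = (f.toLinearEquiv.toLinearMap.comp (t • LinearMap.id)) ∘ p := by
    ext1 k; exact h k
  rw [h', Set.range_comp, ← LinearMap.image_convexHull]
  rfl

end CentredRegular

/-! ### Vertices as extreme points -/

section Vertices

variable {ι V : Type*} [AddCommGroup V] [Module ℝ V]

/-- The extreme points of a simplex are its vertices. -/
lemma AffineBasis.extremePoints_convexHull [Fintype ι] (b : AffineBasis ι ℝ V) :
    (convexHull ℝ (Set.range b)).extremePoints ℝ = Set.range b := by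
  classical
  refine extremePoints_convexHull_subset.antisymm ?_
  rintro _ ⟨k, rfl⟩
  refine mem_extremePoints_iff_left.2 ⟨subset_convexHull ℝ _ ⟨k, rfl⟩, ?_⟩
  rintro x hx y hy ⟨s, t, hs, ht, hst, hxy⟩
  rw [b.convexHull_eq_nonneg_coord] at hx hy
  refine b.ext_elem fun l => ?_
  by_cases hl : l = k
  · -- the coordinate at `k` cannot exceed `1`
    subst hl
    have hle {z : V} (hz : ∀ i, 0 ≤ b.coord i z) : b.coord l z ≤ 1 := by
      rw [← b.sum_coord_apply_eq_one z]
      exact Finset.single_le_sum (fun i _ => hz i) (Finset.mem_univ l)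
    have h := congrArg (b.coord l) hxy
    rw [Convex.combo_affine_apply hst, b.coord_apply_eq, smul_eq_mul, smul_eq_mul] at h
    rw [b.coord_apply_eq]
    nlinarith [hle hx, hle hy]
  · have h := congrArg (b.coord l) hxy
    rw [Convex.combo_affine_apply hst, b.coord_apply_ne hl, smul_eq_mul, smul_eq_mul] at h
    rw [b.coord_apply_ne hl]
    have h1 := mul_nonneg hs.le (hx l)
    have h2 := mul_nonneg ht.le (hy l)
    exact (mul_eq_zero.1 (by linarith : s * b.coord l x = 0)).resolve_left hs.ne'

end Vertices

/-! ### Comparison with the regular simplex -/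

section RadialMeasure

variable {d : ℕ}

local notation "E" => EuclideanSpace ℝ (Fin d)

lemma integrableOn_radial {φ : ℝ → ℝ} (hφ : Measurable φ) {C : ℝ} (h0 : ∀ t, 0 ≤ φ t)
    (hC : ∀ t, φ t ≤ C) {K : Set E} (hK : IsCompact K) :
    IntegrableOn (fun x => φ ‖x‖) K := by
  refine Measure.integrableOn_of_bounded (M := C) hK.measure_lt_top.ne
    (hφ.comp measurable_norm).aestronglyMeasurable (Filter.Eventually.of_forall fun x => ?_)
  rw [Real.norm_eq_abs, abs_of_nonneg (h0 _)]
  exact hC _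

lemma radialMeasure_eq_toReal {φ : ℝ → ℝ} (hφ : Measurable φ) (h0 : ∀ t, 0 ≤ φ t) (K : Set E) :
    radialMeasure φ K = (∫⁻ x in K, ENNReal.ofReal (φ ‖x‖)).toReal :=
  integral_eq_lintegral_of_nonneg_ae (Filter.Eventually.of_forall fun _ => h0 _)
    (hφ.comp measurable_norm).aestronglyMeasurable

lemma radialMeasure_mono {φ : ℝ → ℝ} (hφ : Measurable φ) {C : ℝ} (h0 : ∀ t, 0 ≤ φ t)
    (hC : ∀ t, φ t ≤ C) {K L : Set E} (hL : IsCompact L) (h : K ⊆ L) :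
    radialMeasure φ K ≤ radialMeasure φ L :=
  setIntegral_mono_set (integrableOn_radial hφ h0 hC hL)
    (Filter.Eventually.of_forall fun _ => h0 _) h.eventuallyLE

lemma radialMeasure_image (φ : ℝ → ℝ) (f : E ≃ₗᵢ[ℝ] E) (K : Set E) :
    radialMeasure φ (f '' K) = radialMeasure φ K := by
  rw [radialMeasure, f.measurePreserving.setIntegral_image_emb
    f.toHomeomorph.measurableEmbedding]
  simp only [f.norm_map, radialMeasure]

lemma radialMeasure_const_sub {φ : ℝ → ℝ} (hφ : Measurable φ) {C : ℝ} (h0 : ∀ t, 0 ≤ φ t)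
    (hC : ∀ t, φ t ≤ C) {K : Set E} (hK : IsCompact K) :
    radialMeasure (fun t => C - φ t) K = C * volume.real K - radialMeasure φ K := by
  have hconst : IntegrableOn (fun _ : E => C) K := integrableOn_const hK.measure_lt_top.ne
  rw [radialMeasure, radialMeasure, integral_sub hconst (integrableOn_radial hφ h0 hC hK),
    setIntegral_const, smul_eq_mul, mul_comm]

lemma zero_mem_convexHull_of_sum_eq_zero {p : Fin (d + 1) → E} (h : ∑ k, p k = 0) :
    (0 : E) ∈ convexHull ℝ (Set.range p) := by
  have h1 : ∑ k, (d + 1 : ℝ)⁻¹ • p k ∈ convexHull ℝ (Set.range p) := by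
    refine (convex_convexHull ℝ _).sum_mem (fun _ _ => by positivity) ?_
      fun k _ => subset_convexHull ℝ _ ⟨k, rfl⟩
    simp only [Finset.sum_const, Finset.card_univ, Fintype.card_fin, nsmul_eq_mul]
    push_cast
    field_simp
  rwa [← Finset.smul_sum, h, smul_zero] at h1

lemma similarity_image_subset {K : Set E} (hK : Convex ℝ K) (h0 : (0 : E) ∈ K) {t : ℝ}
    (ht : 0 ≤ t) (ht1 : t ≤ 1) (f : E ≃ₗᵢ[ℝ] E) : (fun x => f (t • x)) '' K ⊆ f '' K := by
  rintro _ ⟨x, hx, rfl⟩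
  exact ⟨t • x, hK.smul_mem_of_zero_mem h0 hx ⟨ht, ht1⟩, rfl⟩

lemma subset_similarity_image {K : Set E} (hK : Convex ℝ K) (h0 : (0 : E) ∈ K) {t : ℝ}
    (ht : 1 ≤ t) (f : E ≃ₗᵢ[ℝ] E) : f '' K ⊆ (fun x => f (t • x)) '' K := by
  rintro _ ⟨x, hx, rfl⟩
  have ht0 : 0 < t := by linarith
  refine ⟨t⁻¹ • x, hK.smul_mem_of_zero_mem h0 hx ⟨by positivity, inv_le_one_of_one_le₀ ht⟩, ?_⟩
  simp only [smul_inv_smul₀ ht0.ne']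

lemma nontrivial_euclideanSpace (hd : 1 ≤ d) : Nontrivial E := by
  have : Nonempty (Fin d) := ⟨⟨0, hd⟩⟩
  infer_instance

/-- Every simplex can be improved to a regular simplex centred at the origin. -/
lemma exists_similar_improvement (hd : 1 ≤ d) {φ : ℝ → ℝ} (hφ : Antitone φ) {C : ℝ}
    (h0 : ∀ t, 0 ≤ φ t) (hC : ∀ t, φ t ≤ C) (b s : AffineBasis (Fin (d + 1)) ℝ E) {a : ℝ}
    (hs : IsCentredRegular s a) :
    ∃ t : ℝ, 0 < t ∧ ∃ f : E ≃ₗᵢ[ℝ] E,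
      volume ((fun x => f (t • x)) '' convexHull ℝ (Set.range s)) =
        volume (convexHull ℝ (Set.range b)) ∧
      radialMeasure φ (convexHull ℝ (Set.range b)) ≤
        radialMeasure φ ((fun x => f (t • x)) '' convexHull ℝ (Set.range s)) ∧
      t * outerRadius (convexHull ℝ (Set.range s)) ≤ outerRadius (convexHull ℝ (Set.range b)) ∧
      innerRadius (convexHull ℝ (Set.range b)) ≤
        t * innerRadius (convexHull ℝ (Set.range s)) := by
  have := nontrivial_euclideanSpace hd
  obtain ⟨b', hbal, hvol, hN, hcr, hir⟩ := exists_balanced_improvement hφ hC b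
  obtain ⟨t, ht, f, hf⟩ := hs.exists_similarity hd (isCentredRegular_of_isEdgeBalanced b' hbal)
  have hK := convexHull_range_similarity f hf
  refine ⟨t, ht, f, ?_, ?_, ?_, ?_⟩
  · rw [← hK, hvol]
  · rw [← hK, radialMeasure_eq_toReal hφ.measurable h0, radialMeasure_eq_toReal hφ.measurable h0]
    exact ENNReal.toReal_mono (lintegral_convexHull_ne_top hC _) hN
  · rwa [← outerRadius_similarity (isCompact_convexHull_range s).isBounded ht f, ← hK]
  · rwa [← innerRadius_similarity (isCompact_convexHull_range s) ht f, ← hK]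

lemma outerRadius_convexHull_pos (hd : 1 ≤ d) (s : AffineBasis (Fin (d + 1)) ℝ E) :
    0 < outerRadius (convexHull ℝ (Set.range s)) := by
  refine outerRadius_pos (isCompact_convexHull_range s).isBounded
    ⟨s 0, subset_convexHull ℝ _ ⟨0, rfl⟩, s (Fin.last d), subset_convexHull ℝ _ ⟨_, rfl⟩, ?_⟩
  intro h
  have := congrArg Fin.val (s.ind.injective h)
  simp at this
  omega

lemma innerRadius_convexHull_pos (hd : 1 ≤ d) (s : AffineBasis (Fin (d + 1)) ℝ E) :
    0 < innerRadius (convexHull ℝ (Set.range s)) :=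
  have := nontrivial_euclideanSpace hd
  innerRadius_pos (isCompact_convexHull_range s).isBounded (interior_convexHull_nonempty s)

theorem radialMeasure_le_of_antitone (hd : 1 ≤ d) {φ : ℝ → ℝ} (hφ : Antitone φ) {C : ℝ}
    (h0 : ∀ t, 0 ≤ φ t) (hC : ∀ t, φ t ≤ C) (b s : AffineBasis (Fin (d + 1)) ℝ E) {a : ℝ}
    (hs : IsCentredRegular s a) (hsum : ∑ k, s k = 0)
    (hcr : outerRadius (convexHull ℝ (Set.range b)) ≤ outerRadius (convexHull ℝ (Set.range s))) :
    radialMeasure φ (convexHull ℝ (Set.range b)) ≤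
      radialMeasure φ (convexHull ℝ (Set.range s)) := by
  obtain ⟨t, ht, f, -, hN, hr, -⟩ := exists_similar_improvement hd hφ h0 hC b s hs
  have ht1 : t ≤ 1 := by
    have := outerRadius_convexHull_pos hd s
    exact le_of_mul_le_mul_right (by linarith) this
  refine hN.trans ?_
  rw [← radialMeasure_image φ f (convexHull ℝ (Set.range s))]
  exact radialMeasure_mono hφ.measurable h0 hC
    ((isCompact_convexHull_range s).image f.continuous)
    (similarity_image_subset (convex_convexHull ℝ _) (zero_mem_convexHull_of_sum_eq_zero hsum)
      ht.le ht1 f)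

theorem radialMeasure_le_of_monotone (hd : 1 ≤ d) {φ : ℝ → ℝ} (hφ : Monotone φ) {C : ℝ}
    (h0 : ∀ t, 0 ≤ φ t) (hC : ∀ t, φ t ≤ C) (b s : AffineBasis (Fin (d + 1)) ℝ E) {a : ℝ}
    (hs : IsCentredRegular s a) (hsum : ∑ k, s k = 0)
    (hir : innerRadius (convexHull ℝ (Set.range s)) ≤ innerRadius (convexHull ℝ (Set.range b))) :
    radialMeasure φ (convexHull ℝ (Set.range s)) ≤
      radialMeasure φ (convexHull ℝ (Set.range b)) := by
  -- The complementary density `C - φ` is decreasing.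
  obtain ⟨t, ht, f, hvol, hN, -, hr⟩ := exists_similar_improvement hd (φ := fun t => C - φ t)
    (fun x y hxy => sub_le_sub_left (hφ hxy) C) (C := C) (fun t => sub_nonneg.2 (hC t))
    (fun t => sub_le_self _ (h0 t)) b s hs
  have ht1 : 1 ≤ t := by
    have := innerRadius_convexHull_pos hd s
    exact le_of_mul_le_mul_right (by linarith) this
  have hcont : Continuous fun x => f (t • x) := by fun_prop
  have hKc := (isCompact_convexHull_range s).image hcont
  rw [radialMeasure_const_sub hφ.measurable h0 hC (isCompact_convexHull_range b),
    radialMeasure_const_sub hφ.measurable h0 hC hKc, measureReal_def, measureReal_def, hvol] at hN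
  have h1 := radialMeasure_mono hφ.measurable h0 hC hKc
    (subset_similarity_image (convex_convexHull ℝ _) (zero_mem_convexHull_of_sum_eq_zero hsum)
      ht1 f)
  rw [radialMeasure_image] at h1
  linarith

lemma exists_symmetral_basis (b : AffineBasis (Fin (d + 1)) ℝ E) {i j : Fin (d + 1)}
    (hij : i ≠ j) : ∃ b' : AffineBasis (Fin (d + 1)) ℝ E, ⇑b' = edgeSwap b i j ∘ b :=
  exists_affineBasis_of_volume_ne_zero
    ((volume_symmetral b hij).trans_ne (volume_convexHull_ne_zero b))

/-- For strictly decreasing densities only simplices with balanced edges are extremal. -/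
lemma isEdgeBalanced_of_radialMeasure_eq_of_antitone (hd : 1 ≤ d) {φ : ℝ → ℝ}
    (hφ : Antitone φ) {C : ℝ} (h0 : ∀ t, 0 ≤ φ t) (hC : ∀ t, φ t ≤ C) {m : ℝ}
    (hm : StrictAntiOn φ (Set.Icc 0 m))
    (b s : AffineBasis (Fin (d + 1)) ℝ E) {a : ℝ} (hs : IsCentredRegular s a)
    (hsum : ∑ k, s k = 0) (hbm : convexHull ℝ (Set.range b) ⊆ Metric.closedBall 0 m)
    (hcr : outerRadius (convexHull ℝ (Set.range b)) ≤ outerRadius (convexHull ℝ (Set.range s)))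
    (heq : radialMeasure φ (convexHull ℝ (Set.range b)) =
      radialMeasure φ (convexHull ℝ (Set.range s))) (i j : Fin (d + 1)) (hij : i ≠ j) :
    IsEdgeBalanced b i j := by
  by_contra hb
  obtain ⟨b', hb'⟩ := exists_symmetral_basis b hij
  have h1 := lintegral_lt_symmetral b hφ hC h0 hm hbm hij hb
  rw [← hb'] at h1
  have h2 := (ENNReal.toReal_lt_toReal (lintegral_convexHull_ne_top hC _)
    (lintegral_convexHull_ne_top hC _)).2 h1
  rw [← radialMeasure_eq_toReal hφ.measurable h0, ← radialMeasure_eq_toReal hφ.measurable h0] at h2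
  have h3 := outerRadius_symmetral_le b hij
  rw [← hb'] at h3
  have h4 := radialMeasure_le_of_antitone hd hφ h0 hC b' s hs hsum (h3.trans hcr)
  linarith

/-- For strictly increasing densities only simplices with balanced edges are extremal. -/
lemma isEdgeBalanced_of_radialMeasure_eq_of_monotone (hd : 1 ≤ d) {φ : ℝ → ℝ}
    (hφ : Monotone φ) {C : ℝ} (h0 : ∀ t, 0 ≤ φ t) (hC : ∀ t, φ t ≤ C) {m : ℝ}
    (hm : StrictMonoOn φ (Set.Icc 0 m))
    (b s : AffineBasis (Fin (d + 1)) ℝ E) {a : ℝ} (hs : IsCentredRegular s a)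
    (hsum : ∑ k, s k = 0) (hbm : convexHull ℝ (Set.range b) ⊆ Metric.closedBall 0 m)
    (hir : innerRadius (convexHull ℝ (Set.range s)) ≤ innerRadius (convexHull ℝ (Set.range b)))
    (heq : radialMeasure φ (convexHull ℝ (Set.range b)) =
      radialMeasure φ (convexHull ℝ (Set.range s))) (i j : Fin (d + 1)) (hij : i ≠ j) :
    IsEdgeBalanced b i j := by
  have := nontrivial_euclideanSpace hd
  by_contra hb
  obtain ⟨b', hb'⟩ := exists_symmetral_basis b hij
  have hψ : Antitone fun t => C - φ t := fun x y hxy => sub_le_sub_left (hφ hxy) C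
  have hψ0 : ∀ t, 0 ≤ C - φ t := fun t => sub_nonneg.2 (hC t)
  have hψC : ∀ t, C - φ t ≤ C := fun t => sub_le_self _ (h0 t)
  have h1 := lintegral_lt_symmetral b hψ hψC hψ0
    (fun x hx y hy hxy => sub_lt_sub_left (hm hx hy hxy) C) hbm hij hb
  have hvol := volume_symmetral b hij
  have h3 := innerRadius_le_symmetral b hij
  rw [← hb'] at h1 hvol h3
  have h2 := (ENNReal.toReal_lt_toReal (lintegral_convexHull_ne_top hψC _)
    (lintegral_convexHull_ne_top hψC _)).2 h1
  rw [← radialMeasure_eq_toReal hψ.measurable hψ0, ← radialMeasure_eq_toReal hψ.measurable hψ0,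
    radialMeasure_const_sub hφ.measurable h0 hC (isCompact_convexHull_range _),
    radialMeasure_const_sub hφ.measurable h0 hC (isCompact_convexHull_range _),
    measureReal_def, measureReal_def, hvol] at h2
  have h4 := radialMeasure_le_of_monotone hd hφ h0 hC b' s hs hsum (hir.trans h3)
  linarith

/-- A simplex with balanced edges and the same circumradius or the same inradius as a centred
regular simplex is congruent to it. -/
lemma areCongruent_of_isEdgeBalanced (hd : 1 ≤ d) (b s : AffineBasis (Fin (d + 1)) ℝ E) {a : ℝ}
    (hs : IsCentredRegular s a) (hb : ∀ i j, i ≠ j → IsEdgeBalanced b i j)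
    (h : outerRadius (convexHull ℝ (Set.range b)) = outerRadius (convexHull ℝ (Set.range s)) ∨
      innerRadius (convexHull ℝ (Set.range b)) = innerRadius (convexHull ℝ (Set.range s))) :
    AreCongruent (convexHull ℝ (Set.range b)) (convexHull ℝ (Set.range s)) := by
  have := nontrivial_euclideanSpace hd
  obtain ⟨t, ht, f, hf⟩ := hs.exists_similarity hd (isCentredRegular_of_isEdgeBalanced b hb)
  have hK := convexHull_range_similarity f hf
  have ht1 : t = 1 := by
    rcases h with h | h
    · rw [hK, outerRadius_similarity (isCompact_convexHull_range s).isBounded ht] at h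
      exact mul_right_cancel₀ (outerRadius_convexHull_pos hd s).ne' (by rw [h, one_mul])
    · rw [hK, innerRadius_similarity (isCompact_convexHull_range s) ht] at h
      exact mul_right_cancel₀ (innerRadius_convexHull_pos hd s).ne' (by rw [h, one_mul])
  refine ⟨f.symm.toIsometryEquiv, ?_⟩
  rw [hK, ht1, Set.image_image]
  simp

/-- A congruence between two simplices with centre at the origin permutes the vertices, hence fixes
the origin. -/
lemma IsometryEquiv.map_zero_of_image_convexHull_eq (f : E ≃ᵢ E)
    (b s : AffineBasis (Fin (d + 1)) ℝ E) (hb : ∑ k, b k = 0) (hs : ∑ k, s k = 0)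
    (h : f '' convexHull ℝ (Set.range b) = convexHull ℝ (Set.range s)) : f 0 = 0 := by
  classical
  set A := f.toRealAffineIsometryEquiv with hA
  have hAf (x : E) : A x = f x := rfl
  have hconv : convexHull ℝ (Set.range (f ∘ b)) = convexHull ℝ (Set.range s) := by
    rw [← h, Set.range_comp]
    exact (AffineMap.image_convexHull A.toAffineEquiv.toAffineMap _).symm
  obtain ⟨b', hb'⟩ := exists_affineBasis_of_volume_ne_zero (p := f ∘ b)
    (by rw [hconv]; exact volume_convexHull_ne_zero s)
  have hrange : Set.range b' = Set.range s := by
    rw [← b'.extremePoints_convexHull, ← s.extremePoints_convexHull, hb', hconv]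
  have himg : Finset.univ.image b' = Finset.univ.image s := by
    rw [← Finset.coe_inj]; simpa using hrange
  have hsum : ∑ k, b' k = ∑ k, s k := by
    have h1 := Finset.sum_image (f := fun x : E => x) (s := Finset.univ) b'.ind.injective.injOn
    have h2 := Finset.sum_image (f := fun x : E => x) (s := Finset.univ) s.ind.injective.injOn
    exact h1.symm.trans ((congrArg (fun t => ∑ x ∈ t, x) himg).trans h2)
  have hf (x : E) : f x = A.linearIsometryEquiv x + f 0 := by
    have := A.map_vadd 0 x
    simpa [hAf] using this
  rw [hs, hb'] at hsum
  simp only [Function.comp_apply] at hsum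
  rw [Finset.sum_congr rfl fun k _ => hf (b k), Finset.sum_add_distrib, ← map_sum, hb, map_zero,
    zero_add, Finset.sum_const, Finset.card_univ, Fintype.card_fin, ← Nat.cast_smul_eq_nsmul ℝ,
    smul_eq_zero] at hsum
  exact hsum.resolve_left (by positivity)

lemma radialMeasure_eq_of_areCongruent (φ : ℝ → ℝ) (b s : AffineBasis (Fin (d + 1)) ℝ E)
    (hb : ∑ k, b k = 0) (hs : ∑ k, s k = 0)
    (h : AreCongruent (convexHull ℝ (Set.range b)) (convexHull ℝ (Set.range s))) :
    radialMeasure φ (convexHull ℝ (Set.range b)) =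
      radialMeasure φ (convexHull ℝ (Set.range s)) := by
  obtain ⟨f, hf⟩ := h
  have hf0 := f.map_zero_of_image_convexHull_eq b s hb hs hf
  rw [← hf, ← radialMeasure_image φ (f.toRealLinearIsometryEquivOfMapZero hf0)]
  rfl

end RadialMeasure

/-! ### Reduction to bounded densities on the whole line -/

section Densities

variable {d : ℕ}

local notation "E" => EuclideanSpace ℝ (Fin d)

/-- The density `ρ` continued beyond `[0, m]` by its values at the endpoints. -/
def clampDensity (ρ : ℝ → ℝ) (m t : ℝ) : ℝ := ρ (max 0 (min t m))

lemma clampDensity_of_mem (ρ : ℝ → ℝ) {m t : ℝ} (ht : t ∈ Set.Icc 0 m) :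
    clampDensity ρ m t = ρ t := by
  rw [clampDensity, min_eq_left ht.2, max_eq_right ht.1]

lemma max_min_mem_Icc {m : ℝ} (hm : 0 ≤ m) (t : ℝ) : max 0 (min t m) ∈ Set.Icc 0 m :=
  ⟨le_max_left _ _, max_le hm (min_le_right _ _)⟩

lemma clampDensity_antitone {ρ : ℝ → ℝ} {m : ℝ} (hm : 0 ≤ m) (hρ : AntitoneOn ρ (Set.Icc 0 m)) :
    Antitone (clampDensity ρ m) := fun _ _ hxy =>
  hρ (max_min_mem_Icc hm _) (max_min_mem_Icc hm _) (max_le_max_left _ (min_le_min_right _ hxy))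

lemma clampDensity_monotone {ρ : ℝ → ℝ} {m : ℝ} (hm : 0 ≤ m) (hρ : MonotoneOn ρ (Set.Icc 0 m)) :
    Monotone (clampDensity ρ m) := fun _ _ hxy =>
  hρ (max_min_mem_Icc hm _) (max_min_mem_Icc hm _) (max_le_max_left _ (min_le_min_right _ hxy))

lemma radialMeasure_clampDensity (ρ : ℝ → ℝ) {m : ℝ} {K : Set E} (hK : IsCompact K)
    (hKm : K ⊆ Metric.closedBall 0 m) :
    radialMeasure (clampDensity ρ m) K = radialMeasure ρ K :=
  setIntegral_congr_fun hK.measurableSet fun _ hx =>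
    clampDensity_of_mem ρ ⟨norm_nonneg _, mem_closedBall_zero_iff.1 (hKm hx)⟩

lemma integrableOn_of_clampDensity {ρ : ℝ → ℝ} {m : ℝ} {K : Set E} (hK : IsCompact K)
    (hKm : K ⊆ Metric.closedBall 0 m)
    (h : IntegrableOn (fun x => clampDensity ρ m ‖x‖) K) : IntegrableOn (fun x => ρ ‖x‖) K :=
  h.congr_fun (fun _ hx =>
    clampDensity_of_mem ρ ⟨norm_nonneg _, mem_closedBall_zero_iff.1 (hKm hx)⟩) hK.measurableSet

/-- Compact subsets of the domain stay away from its boundary. -/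
lemma exists_subset_ball_of_subset_centredDomain {R₀ : EReal} {K : Set E} (hK : IsCompact K)
    (hne : K.Nonempty) (h : K ⊆ centredDomain d R₀) :
    ∃ m : ℝ, 0 ≤ m ∧ (m : EReal) < R₀ ∧ K ⊆ Metric.ball 0 m := by
  obtain ⟨x, hx, hmax⟩ := hK.exists_isMaxOn hne continuous_norm.continuousOn
  obtain ⟨m, hm1, hm2⟩ := EReal.lt_iff_exists_real_btwn.1 (h hx)
  have hxm : ‖x‖ < m := EReal.coe_lt_coe_iff.1 hm1
  refine ⟨m, (norm_nonneg x).trans hxm.le, hm2, fun y hy => ?_⟩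
  exact mem_ball_zero_iff.2 ((hmax hy).trans_lt hxm)

lemma Icc_subset_radiusInterval {R₀ : EReal} {m : ℝ} (hm : (m : EReal) < R₀) :
    Set.Icc 0 m ⊆ radiusInterval R₀ := fun _ ht =>
  ⟨ht.1, (EReal.coe_le_coe_iff.2 ht.2).trans_lt hm⟩

lemma simplexCentre_eq_zero_iff {k : ℕ} (S : Affine.Simplex ℝ E k) :
    simplexCentre S = 0 ↔ ∑ i, S.points i = 0 := by
  rw [simplexCentre, Finset.centroid_def, Finset.affineCombination_eq_linear_combination _ _ _
    (Finset.sum_centroidWeights_eq_one_of_card_ne_zero ℝ _ (by simp))]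
  simp only [Finset.centroidWeights_apply]
  rw [← Finset.smul_sum, smul_eq_zero, or_iff_right]
  simp only [Finset.card_univ, Fintype.card_fin]
  positivity

lemma exists_affineBasis_of_simplex (S : Affine.Simplex ℝ E d) :
    ∃ b : AffineBasis (Fin (d + 1)) ℝ E, ⇑b = S.points :=
  ⟨⟨S.points, S.independent,
    S.independent.affineSpan_eq_top_iff_card_eq_finrank_add_one.2 (by simp)⟩, rfl⟩

lemma eq_dim_of_affineSpan_eq_top {k : ℕ} {S : Affine.Simplex ℝ E k}
    (h : affineSpan ℝ (Set.range S.points) = ⊤) : k = d := by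
  have := S.independent.affineSpan_eq_top_iff_card_eq_finrank_add_one.1 h
  simpa using this

/-- Strictly decreasing densities are positive, hence so is the measure of a full-dimensional
simplex. -/
lemma radialMeasure_pos {φ : ℝ → ℝ} (hφ : Antitone φ) {C : ℝ} (h0 : ∀ t, 0 ≤ φ t)
    (hC : ∀ t, φ t ≤ C) {m : ℝ} (hm0 : 0 ≤ m) (hm : StrictAntiOn φ (Set.Icc 0 m)) {K : Set E}
    (hK : IsCompact K) (hKm : K ⊆ Metric.ball 0 m) (hvol : volume K ≠ 0) :
    0 < radialMeasure φ K := by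
  rw [radialMeasure, setIntegral_pos_iff_support_of_nonneg_ae
    (Filter.Eventually.of_forall fun _ => h0 _) (integrableOn_radial hφ.measurable h0 hC hK)]
  have hsupp : K ⊆ Function.support fun x : E => φ ‖x‖ := fun x hx => by
    have hxm : ‖x‖ < m := mem_ball_zero_iff.1 (hKm hx)
    exact ((h0 m).trans_lt (hm ⟨norm_nonneg _, hxm.le⟩ ⟨hm0, le_rfl⟩ hxm)).ne'
  rw [Set.inter_eq_right.2 hsupp]
  exact pos_iff_ne_zero.2 hvol

lemma not_areCongruent_of_dim_ne {k : ℕ} (hk : k ≠ d) (S : Affine.Simplex ℝ E k)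
    (s : AffineBasis (Fin (d + 1)) ℝ E) :
    ¬ AreCongruent (convexHull ℝ (Set.range S.points)) (convexHull ℝ (Set.range s)) := by
  rintro ⟨f, hf⟩
  have hint := interior_convexHull_nonempty s
  rw [← hf, ← f.coe_toHomeomorph, ← f.toHomeomorph.image_interior, Set.image_nonempty,
    interior_convexHull_nonempty_iff_affineSpan_eq_top] at hint
  exact hk (eq_dim_of_affineSpan_eq_top hint)

end Densities

/-! ### The extremal property -/

theorem mainTheorem10 (d : ℕ) (hd : 1 ≤ d) (R₀ : EReal) (ρ : ℝ → ℝ)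
    (hρ : ∀ t ∈ radiusInterval R₀, 0 ≤ ρ t)
    (Sreg : Affine.Simplex ℝ (EuclideanSpace ℝ (Fin d)) d)
    (hreg : Sreg.Regular) (hcentre : simplexCentre Sreg = 0)
    (hsub : Sreg.closedInterior ⊆ centredDomain d R₀) :
    (AntitoneOn ρ (radiusInterval R₀) →
      ∀ (k : ℕ) (S : Affine.Simplex ℝ (EuclideanSpace ℝ (Fin d)) k),
        S.closedInterior ⊆ centredDomain d R₀ →
        outerRadius S.closedInterior = outerRadius Sreg.closedInterior →
        IntegrableOn (fun x => ρ ‖x‖) S.closedInterior ∧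
        radialMeasure ρ S.closedInterior ≤ radialMeasure ρ Sreg.closedInterior ∧
        (StrictAntiOn ρ (radiusInterval R₀) →
          (radialMeasure ρ S.closedInterior = radialMeasure ρ Sreg.closedInterior ↔
            AreCongruent S.closedInterior Sreg.closedInterior ∧ simplexCentre S = 0))) ∧
    (MonotoneOn ρ (radiusInterval R₀) →
      ∀ S : Affine.Simplex ℝ (EuclideanSpace ℝ (Fin d)) d,
        S.closedInterior ⊆ centredDomain d R₀ →
        innerRadius S.closedInterior = innerRadius Sreg.closedInterior →
        IntegrableOn (fun x => ρ ‖x‖) S.closedInterior ∧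
        radialMeasure ρ Sreg.closedInterior ≤ radialMeasure ρ S.closedInterior ∧
        (StrictMonoOn ρ (radiusInterval R₀) →
          (radialMeasure ρ S.closedInterior = radialMeasure ρ Sreg.closedInterior ↔
            AreCongruent S.closedInterior Sreg.closedInterior ∧ simplexCentre S = 0))) := by
  obtain ⟨s, hs⟩ := exists_affineBasis_of_simplex Sreg
  have hsum : ∑ k, s k = 0 := by rw [hs]; exact (simplexCentre_eq_zero_iff Sreg).1 hcentre
  obtain ⟨r, hr⟩ := hreg.equilateral
  rw [← hs] at hr
  have hsreg := isCentredRegular_of_equilateral hsum hr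
  rw [← Sreg.convexHull_eq_closedInterior, ← hs] at hsub ⊢
  have hcs := isCompact_convexHull_range s
  -- Both simplices lie in a ball inside the domain, outside of which `ρ` may be changed.
  have hball {k : ℕ} (S : Affine.Simplex ℝ (EuclideanSpace ℝ (Fin d)) k)
      (hS : convexHull ℝ (Set.range S.points) ⊆ centredDomain d R₀) :
      ∃ m : ℝ, 0 ≤ m ∧ Set.Icc 0 m ⊆ radiusInterval R₀ ∧
        convexHull ℝ (Set.range S.points) ⊆ Metric.ball 0 m ∧
        convexHull ℝ (Set.range s) ⊆ Metric.ball 0 m := by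
    obtain ⟨m, hm0, hm, h⟩ := exists_subset_ball_of_subset_centredDomain
      ((isCompact_convexHull_range S.points).union hcs)
      (Set.Nonempty.inl ⟨_, subset_convexHull ℝ _ ⟨0, rfl⟩⟩) (Set.union_subset hS hsub)
    exact ⟨m, hm0, Icc_subset_radiusInterval hm, Set.subset_union_left.trans h,
      Set.subset_union_right.trans h⟩
  constructor
  · intro hanti k S hS hcr
    rw [← S.convexHull_eq_closedInterior] at hS hcr ⊢
    obtain ⟨m, hm0, hmR, hSm, hsm⟩ := hball S hS
    have hcS := isCompact_convexHull_range S.points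
    have hφ := clampDensity_antitone hm0 (hanti.mono hmR)
    have h0 : ∀ t, 0 ≤ clampDensity ρ m t := fun t => hρ _ (hmR (max_min_mem_Icc hm0 t))
    have hC : ∀ t, clampDensity ρ m t ≤ ρ 0 := fun t =>
      hanti (hmR ⟨le_rfl, hm0⟩) (hmR (max_min_mem_Icc hm0 t)) (le_max_left _ _)
    have hstrict (h : StrictAntiOn ρ (radiusInterval R₀)) :
        StrictAntiOn (clampDensity ρ m) (Set.Icc 0 m) :=
      (h.mono hmR).congr fun t ht => (clampDensity_of_mem ρ ht).symm
    have hSm' := hSm.trans Metric.ball_subset_closedBall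
    refine ⟨integrableOn_of_clampDensity hcS hSm'
      (integrableOn_radial hφ.measurable h0 hC hcS), ?_⟩
    rw [← radialMeasure_clampDensity ρ hcS hSm',
      ← radialMeasure_clampDensity ρ hcs (hsm.trans Metric.ball_subset_closedBall)]
    by_cases hk : k = d
    · subst hk
      obtain ⟨b, hb⟩ := exists_affineBasis_of_simplex S
      rw [simplexCentre_eq_zero_iff, ← hb]
      rw [← hb] at hcr hSm'
      refine ⟨radialMeasure_le_of_antitone hd hφ h0 hC b s hsreg hsum hcr.le,
        fun hst => ⟨fun heq => ?_, fun h => radialMeasure_eq_of_areCongruent _ b s h.2 hsum h.1⟩⟩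
      have hbal := isEdgeBalanced_of_radialMeasure_eq_of_antitone hd hφ h0 hC (hstrict hst) b s
        hsreg hsum hSm' hcr.le heq
      exact ⟨areCongruent_of_isEdgeBalanced hd b s hsreg hbal (Or.inl hcr),
        sum_eq_zero_of_isEdgeBalanced b hbal⟩
    · -- A simplex of lower dimension is a null set.
      have hvol : volume (convexHull ℝ (Set.range S.points)) = 0 := by
        by_contra h
        exact hk (eq_dim_of_affineSpan_eq_top (affineSpan_eq_top_of_volume_ne_zero h))
      have hzero : radialMeasure (clampDensity ρ m) (convexHull ℝ (Set.range S.points)) = 0 :=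
        setIntegral_measure_zero _ hvol
      rw [hzero]
      refine ⟨integral_nonneg fun _ => h0 _, fun hst => ⟨fun heq => ?_, fun h => ?_⟩⟩
      · exact absurd heq (radialMeasure_pos hφ h0 hC hm0 (hstrict hst) hcs hsm
          (volume_convexHull_ne_zero s)).ne
      · exact absurd h.1 (not_areCongruent_of_dim_ne hk S s)
  · intro hmono S hS hir
    rw [← S.convexHull_eq_closedInterior] at hS hir ⊢
    obtain ⟨m, hm0, hmR, hSm, hsm⟩ := hball S hS
    have hcS := isCompact_convexHull_range S.points
    have hφ := clampDensity_monotone hm0 (hmono.mono hmR)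
    have h0 : ∀ t, 0 ≤ clampDensity ρ m t := fun t => hρ _ (hmR (max_min_mem_Icc hm0 t))
    have hC : ∀ t, clampDensity ρ m t ≤ ρ m := fun t =>
      hmono (hmR (max_min_mem_Icc hm0 t)) (hmR ⟨hm0, le_rfl⟩) (max_min_mem_Icc hm0 t).2
    have hSm' := hSm.trans Metric.ball_subset_closedBall
    refine ⟨integrableOn_of_clampDensity hcS hSm'
      (integrableOn_radial hφ.measurable h0 hC hcS), ?_⟩
    rw [← radialMeasure_clampDensity ρ hcS hSm',
      ← radialMeasure_clampDensity ρ hcs (hsm.trans Metric.ball_subset_closedBall)]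
    obtain ⟨b, hb⟩ := exists_affineBasis_of_simplex S
    rw [simplexCentre_eq_zero_iff, ← hb]
    rw [← hb] at hir hSm'
    refine ⟨radialMeasure_le_of_monotone hd hφ h0 hC b s hsreg hsum hir.ge,
      fun hst => ⟨fun heq => ?_, fun h => radialMeasure_eq_of_areCongruent _ b s h.2 hsum h.1⟩⟩
    have hbal := isEdgeBalanced_of_radialMeasure_eq_of_monotone hd hφ h0 hC
      ((hst.mono hmR).congr fun t ht => (clampDensity_of_mem ρ ht).symm) b s hsreg hsum
      hSm' hir.ge heq
    exact ⟨areCongruent_of_isEdgeBalanced hd b s hsreg hbal (Or.inr hir),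
      sum_eq_zero_of_isEdgeBalanced b hbal⟩
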